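/- Let $a,m,n>0$ be real. On $\mathbb{R}^4$ let $|x|^2=\sum_i (x^i)^2$, let $g_0$ be the standard metric, let $$g_a=(a|x|^2+1)\,g_0-\frac{a(a|x|^2+2)}{a|x|^2+1}\left(-x^2dx^1+x^1dx^2-x^4dx^3+x^3dx^4\right)^2$$ be the Hawking Taub-NUT metric, and let $$W=W_{m,n}=-mx^2\frac{\partial}{\partial x^1}+mx^1\frac{\partial}{\partial x^2}-nx^4\frac{\partial}{\partial x^3}+nx^3\frac{\partial}{\partial x^4}.$$ Write $g_a=g_{ij}dx^idx^j$, $W_i=g_{ij}W^j$, $|W|^2=W_iW^i$ and $\lambda=1-|W|^2$. The navigation data $(g_a,W_{m,n})$ define the function $$F(x,y)=\sqrt{a_{ij}(x)y^iy^j}+b_i(x)y^i,\qquad a_{ij}=\frac{g_{ij}}{\lambda}+\frac{W_iW_j}{\lambda^2},\qquad b_j=-\frac{W_j}{\lambda}.$$ With $p=\max\{m,n\}$, let $\Omega=\{x\in\mathbb{R}^4 : f(x)<1\}$, where $$f(x)=\frac{p\,|x|^2}{1+a|x|^2}\left(p+2a|m-n||x|^2+a^2|m-n||x|^4\right).$$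 Then $\Omega$ is an open neighbourhood of the origin, $|W|<1$ on $\Omega$, and on $\Omega$ the function $F$ has the following properties: (i) $F$ is a Randers metric, that is, a Finsler metric of the form $\alpha+\beta$ with $\alpha$ the norm of a Riemannian metric and $\beta$ a $1$-form with $\|\beta\|_\alpha<1$; (ii) $F$ is Einstein with Ricci scalar zero, that is, $\mathrm{Ric}(x,y)=0$ for all $x\in\Omega$ and $y\neq0$; (iii) $F$ does not have constant flag curvature. More generally, (i), (ii) and (iii) hold on every open set $U\ni 0$ on which $|W|<1$. Thus $(a,m,n)$ parametrize a $3$-parameter family of such metrics. If $m=n$ and $m^2\le a$, then $\Omega=\mathbb{R}^4$, so that the metric is global on $\mathbb{R}^4$. -/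

import Mathlib

open scoped ContDiff

noncomputable section

namespace Finsler

variable {d : ℕ}

/-- The partial derivative `∂h/∂z^i` of a function on `ℝ^d`. -/
def partialDeriv (i : Fin d) (h : (Fin d → ℝ) → ℝ) (z : Fin d → ℝ) : ℝ :=
  fderiv ℝ h z (Pi.single i 1)

/-- For a function `H(x, y)` of position and velocity: the derivative `∂H/∂x^i`. -/
def dx (i : Fin d) (H : (Fin d → ℝ) → (Fin d → ℝ) → ℝ) (x y : Fin d → ℝ) : ℝ :=
  partialDeriv i (fun z => H z y) x

/-- For a function `H(x, y)` of position and velocity: the derivative `∂H/∂y^i`. -/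
def dy (i : Fin d) (H : (Fin d → ℝ) → (Fin d → ℝ) → ℝ) (x y : Fin d → ℝ) : ℝ :=
  partialDeriv i (fun v => H x v) y

/-- The fundamental tensor `g_{ij}(x, y) = (1/2) ∂²(F²)/∂y^i∂y^j`. -/
def fundamentalTensor (F : (Fin d → ℝ) → (Fin d → ℝ) → ℝ) (x y : Fin d → ℝ) :
    Matrix (Fin d) (Fin d) ℝ :=
  Matrix.of fun i j => (1 / 2 : ℝ) * dy i (dy j fun x y => F x y ^ 2) x y

/-- `F` is a Finsler metric on the open set `U ⊆ ℝ^d`, where `T U = U × ℝ^d`: it is smooth away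
from the zero section, positive, positively homogeneous and strongly convex on each fibre. -/
structure IsFinslerMetric (F : (Fin d → ℝ) → (Fin d → ℝ) → ℝ) (U : Set (Fin d → ℝ)) :
    Prop where
  smooth : ContDiffOn ℝ ∞ (fun p : (Fin d → ℝ) × (Fin d → ℝ) => F p.1 p.2)
    (U ×ˢ {y | y ≠ 0})
  pos : ∀ x ∈ U, ∀ y, y ≠ 0 → 0 < F x y
  homogeneous : ∀ x ∈ U, ∀ y, ∀ c : ℝ, 0 < c → F x (c • y) = c * F x y
  convex : ∀ x ∈ U, ∀ y, y ≠ 0 → (fundamentalTensor F x y).PosDef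

/-- The geodesic coefficients
`G^i = (1/4) g^{il} ( [F²]_{x^k y^l} y^k - [F²]_{x^l} )`. -/
def geodesicCoeff (F : (Fin d → ℝ) → (Fin d → ℝ) → ℝ) (i : Fin d) (x y : Fin d → ℝ) : ℝ :=
  (1 / 4 : ℝ) * ∑ l, (fundamentalTensor F x y)⁻¹ i l *
    ((∑ k, dx k (dy l fun x y => F x y ^ 2) x y * y k) - dx l (fun x y => F x y ^ 2) x y)

/-- The Riemann curvature
`R^i_k = 2 ∂G^i/∂x^k - y^j ∂²G^i/∂x^j∂y^k + 2 G^j ∂²G^i/∂y^j∂y^k - ∂G^i/∂y^j ∂G^j/∂y^k`. -/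
def riemannCurvature (F : (Fin d → ℝ) → (Fin d → ℝ) → ℝ) (i k : Fin d) (x y : Fin d → ℝ) : ℝ :=
  2 * dx k (geodesicCoeff F i) x y
    - (∑ j, y j * dx j (dy k (geodesicCoeff F i)) x y)
    + 2 * (∑ j, geodesicCoeff F j x y * dy j (dy k (geodesicCoeff F i)) x y)
    - ∑ j, dy j (geodesicCoeff F i) x y * dy k (geodesicCoeff F j) x y

/-- The Ricci curvature `Ric = R^k_k`. -/
def ricciCurvature (F : (Fin d → ℝ) → (Fin d → ℝ) → ℝ) (x y : Fin d → ℝ) : ℝ :=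
  ∑ k, riemannCurvature F k k x y

/-- `F` is Einstein on `U` with factor `K = K(x)`, that is `Ric = (d - 1) K F²` on `T U` without
its zero section; the Ricci scalar is `(d - 1) K`. -/
def IsEinsteinWith (F : (Fin d → ℝ) → (Fin d → ℝ) → ℝ) (U : Set (Fin d → ℝ))
    (K : (Fin d → ℝ) → ℝ) : Prop :=
  ∀ x ∈ U, ∀ y, y ≠ 0 → ricciCurvature F x y = ((d : ℝ) - 1) * K x * F x y ^ 2

/-- `F` has constant flag curvature on `U`: for some real `K`,
`R^i_k = K (F² δ^i_k - F F_{y^k} y^i)` on `T U` without its zero section. -/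
def HasConstantFlagCurvature (F : (Fin d → ℝ) → (Fin d → ℝ) → ℝ) (U : Set (Fin d → ℝ)) : Prop :=
  ∃ K : ℝ, ∀ x ∈ U, ∀ y, y ≠ 0 → ∀ i k, riemannCurvature F i k x y =
    K * (F x y ^ 2 * (1 : Matrix (Fin d) (Fin d) ℝ) i k - F x y * dy k F x y * y i)

/-- A matrix field is (the coordinate expression of) a smooth Riemannian metric on `U`. -/
def IsRiemannianMetric (g : (Fin d → ℝ) → Matrix (Fin d) (Fin d) ℝ) (U : Set (Fin d → ℝ)) :
    Prop :=
  (∀ i j, ContDiffOn ℝ ∞ (fun x => g x i j) U) ∧ ∀ x ∈ U, (g x).PosDef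

/-- The function `α + β`, where `α = √(a_{ij} y^i y^j)` and `β = b_i y^i`. -/
def alphaPlusBeta (a : (Fin d → ℝ) → Matrix (Fin d) (Fin d) ℝ) (b : (Fin d → ℝ) → Fin d → ℝ)
    (x y : Fin d → ℝ) : ℝ :=
  √(∑ i, ∑ j, a x i j * y i * y j) + ∑ i, b x i * y i

/-- `F` is a Randers metric on `U`: a Finsler metric of the form `α + β` for a smooth Riemannian
metric `α` and a smooth 1-form `β` with `‖β‖_α² = a^{ij} b_i b_j < 1`. -/
def IsRandersMetric (F : (Fin d → ℝ) → (Fin d → ℝ) → ℝ) (U : Set (Fin d → ℝ)) : Prop :=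
  IsFinslerMetric F U ∧
  ∃ (a : (Fin d → ℝ) → Matrix (Fin d) (Fin d) ℝ) (b : (Fin d → ℝ) → Fin d → ℝ),
    IsRiemannianMetric a U ∧ (∀ i, ContDiffOn ℝ ∞ (fun x => b x i) U) ∧
    (∀ x ∈ U, ∑ i, ∑ j, (a x)⁻¹ i j * b x i * b x j < 1) ∧
    ∀ x ∈ U, ∀ y, F x y = alphaPlusBeta a b x y

section Navigation

variable (g : (Fin d → ℝ) → Matrix (Fin d) (Fin d) ℝ) (W : (Fin d → ℝ) → Fin d → ℝ)

/-- The covector `W_i = g_{ij} W^j`. -/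
def lowered (x : Fin d → ℝ) (i : Fin d) : ℝ := ∑ j, g x i j * W x j

/-- `|W|² = W_i W^i`. -/
def normSq (x : Fin d → ℝ) : ℝ := ∑ i, lowered g W x i * W x i

/-- `λ = 1 - W_i W^i`. -/
def navLambda (x : Fin d → ℝ) : ℝ := 1 - normSq g W x

/-- `a_{ij} = g_{ij} / λ + W_i W_j / λ²`. -/
def navA (x : Fin d → ℝ) : Matrix (Fin d) (Fin d) ℝ :=
  Matrix.of fun i j => g x i j / navLambda g W x
    + lowered g W x i * lowered g W x j / navLambda g W x ^ 2

/-- `b_j = - W_j / λ`. -/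
def navB (x : Fin d → ℝ) (j : Fin d) : ℝ := - lowered g W x j / navLambda g W x

/-- The function `F = α + β` that belongs to the navigation data `(g, W)`. -/
def navigationMetric : (Fin d → ℝ) → (Fin d → ℝ) → ℝ := alphaPlusBeta (navA g W) (navB g W)

end Navigation

/-- The squared Euclidean length `|x|²`. -/
def euclSq (x : Fin 4 → ℝ) : ℝ := ∑ i, x i ^ 2

/-- The components of the 1-form `-x² dx¹ + x¹ dx² - x⁴ dx³ + x³ dx⁴`. -/
def hopfForm (x : Fin 4 → ℝ) : Fin 4 → ℝ := ![-x 1, x 0, -x 3, x 2]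

/-- The Hawking Taub-NUT metric `g_a` on `ℝ⁴`. -/
def taubNUT (a : ℝ) (x : Fin 4 → ℝ) : Matrix (Fin 4) (Fin 4) ℝ :=
  Matrix.of fun i j => (a * euclSq x + 1) * (1 : Matrix (Fin 4) (Fin 4) ℝ) i j
    - a * (a * euclSq x + 2) / (a * euclSq x + 1) * (hopfForm x i * hopfForm x j)

/-- The vector field `W_{m,n} = -m x² ∂₁ + m x¹ ∂₂ - n x⁴ ∂₃ + n x³ ∂₄`. -/
def rotationField (m n : ℝ) (x : Fin 4 → ℝ) : Fin 4 → ℝ :=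
  ![-m * x 1, m * x 0, -n * x 3, n * x 2]

/-- The function
`f(x) = p |x|² / (1 + a |x|²) * (p + 2 a |m - n| |x|² + a² |m - n| |x|⁴)`, `p = max m n`. -/
def radiusBound (a m n : ℝ) (x : Fin 4 → ℝ) : ℝ :=
  max m n * euclSq x / (1 + a * euclSq x) *
    (max m n + 2 * a * |m - n| * euclSq x + a ^ 2 * |m - n| * euclSq x ^ 2)

/-- The region `Ω = {f < 1}`. -/
def region (a m n : ℝ) : Set (Fin 4 → ℝ) := {x | radiusBound a m n x < 1}

/-- The function `F = α + β` on `T ℝ⁴ = ℝ⁴ × ℝ⁴` given by `(g_a, W_{m,n})`. -/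
def taubNUTRanders (a m n : ℝ) : (Fin 4 → ℝ) → (Fin 4 → ℝ) → ℝ :=
  navigationMetric (taubNUT a) (rotationField m n)

end Finsler

end

noncomputable section

namespace Finsler

/-! ### Partial derivatives of functions of position and velocity. -/

section Calculus

variable {d : ℕ}

/-! The function `F` is characterised by Zermelo's navigation equation `|y - F W| = F` in the norm
of `g_a`. Write `z = y - F W`. Differentiating `⟨z, z⟩ = F²` implicitly expresses all first
derivatives of `F` through `z` and the denominator `D = F + ⟨z, W⟩ > 0`, so square roots hardly ever
have to be differentiated. Strong convexity then reduces to the Cauchy-Schwarz inequality against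
`z` (`posDef_fundamentalTensor_navigationMetric`).

The field `W(x) = M x` is linear, `M` is skew and commutes with the complex structure `J` behind the
form in `g_a`; hence `W` is a Killing field. Geodesics of `F` are then geodesics of `g_a` carried
along by the flow of `W`, which suggests the closed formula `G = ½ Γ(z, z) - F M y + ½ F² M² x`. It
is confirmed by checking the Euler-Lagrange equations (`spray_equation`): along the direction `(y,
-2G)` both `F` and `D` are stationary.

For the Ricci curvature, write the derivatives of `G` as a part with `F` held fixed plus a rank-one
part carrying the derivative of `F`. In the trace all terms with `M` and all rank-one terms cancel,
and the Ricci curvature of `F` at `(x, y)` becomes that of `g_a` at `(x, z)`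
(`ricciCurvature_taubNUTRanders`). The latter vanishes by direct computation with explicit
Christoffel symbols (`taubNUT_ricci_flat`).

Constant flag curvature `K` together with zero Ricci curvature forces `K = 0`, but one diagonal
curvature component at the origin is `-2a` (`riemannCurvature_origin`). Everything is proved on the
full set `|W| < 1`; the region `{f < 1}` lies inside it by an elementary estimate of `|W|²`
(`normSq_le_radiusBound`). -/

theorem hasDerivAt_line (v x : Fin d → ℝ) : HasDerivAt (fun t : ℝ => x + t • v) v 0 := by
  simpa using ((hasDerivAt_id (0 : ℝ)).smul_const v).const_add x

/-- Values of derivatives are found along lines, by implicit differentiation. Differentiability must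
be known separately, since a derivative along one line does not determine `fderiv`. -/
theorem partialDeriv_eq_of_hasDerivAt {h : (Fin d → ℝ) → ℝ} {z : Fin d → ℝ} {i : Fin d} {c : ℝ}
    (hh : DifferentiableAt ℝ h z)
    (hc : HasDerivAt (fun t : ℝ => h (z + t • Pi.single i 1)) c 0) :
    partialDeriv i h z = c := by
  have h1 : HasFDerivAt h (fderiv ℝ h z) (z + (0 : ℝ) • Pi.single i 1) := by
    simpa using hh.hasFDerivAt
  exact (h1.comp_hasDerivAt (0 : ℝ) (hasDerivAt_line (Pi.single i 1) z)).unique hc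

variable {H K : (Fin d → ℝ) → (Fin d → ℝ) → ℝ} {x y : Fin d → ℝ}
  {O : Set ((Fin d → ℝ) × (Fin d → ℝ))}

theorem differentiableAt_fst_of_uncurry
    (h : DifferentiableAt ℝ (fun p : (Fin d → ℝ) × (Fin d → ℝ) => H p.1 p.2) (x, y)) :
    DifferentiableAt ℝ (fun z => H z y) x :=
  DifferentiableAt.comp (g := fun p : (Fin d → ℝ) × (Fin d → ℝ) => H p.1 p.2)
    (f := fun z => (z, y)) x h (by fun_prop)

theorem differentiableAt_snd_of_uncurry
    (h : DifferentiableAt ℝ (fun p : (Fin d → ℝ) × (Fin d → ℝ) => H p.1 p.2) (x, y)) :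
    DifferentiableAt ℝ (fun z => H x z) y :=
  DifferentiableAt.comp (g := fun p : (Fin d → ℝ) × (Fin d → ℝ) => H p.1 p.2)
    (f := fun z => (x, z)) y h (by fun_prop)

theorem dx_eq_fderiv (i : Fin d)
    (h : DifferentiableAt ℝ (fun p : (Fin d → ℝ) × (Fin d → ℝ) => H p.1 p.2) (x, y)) :
    dx i H x y = fderiv ℝ (fun p : (Fin d → ℝ) × (Fin d → ℝ) => H p.1 p.2) (x, y)
      (Pi.single i 1, 0) := by
  refine partialDeriv_eq_of_hasDerivAt (differentiableAt_fst_of_uncurry h) ?_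
  have h1 : HasFDerivAt (fun p : (Fin d → ℝ) × (Fin d → ℝ) => H p.1 p.2)
      (fderiv ℝ (fun p : (Fin d → ℝ) × (Fin d → ℝ) => H p.1 p.2) (x, y))
      (x + (0 : ℝ) • Pi.single i 1, y) := by simpa using h.hasFDerivAt
  exact h1.comp_hasDerivAt (0 : ℝ)
    ((hasDerivAt_line (Pi.single i 1) x).prodMk (hasDerivAt_const (0 : ℝ) y))

theorem dy_eq_fderiv (i : Fin d)
    (h : DifferentiableAt ℝ (fun p : (Fin d → ℝ) × (Fin d → ℝ) => H p.1 p.2) (x, y)) :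
    dy i H x y = fderiv ℝ (fun p : (Fin d → ℝ) × (Fin d → ℝ) => H p.1 p.2) (x, y)
      (0, Pi.single i 1) := by
  refine partialDeriv_eq_of_hasDerivAt (differentiableAt_snd_of_uncurry h) ?_
  have h1 : HasFDerivAt (fun p : (Fin d → ℝ) × (Fin d → ℝ) => H p.1 p.2)
      (fderiv ℝ (fun p : (Fin d → ℝ) × (Fin d → ℝ) => H p.1 p.2) (x, y))
      (x, y + (0 : ℝ) • Pi.single i 1) := by simpa using h.hasFDerivAt
  exact h1.comp_hasDerivAt (0 : ℝ)
    ((hasDerivAt_const (0 : ℝ) x).prodMk (hasDerivAt_line (Pi.single i 1) y))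

/-- The derivative of `H` in the direction `(v, w)` in terms of its partial derivatives. -/
theorem sum_dx_add_sum_dy {v w : Fin d → ℝ} {c : ℝ}
    (h : DifferentiableAt ℝ (fun p : (Fin d → ℝ) × (Fin d → ℝ) => H p.1 p.2) (x, y))
    (hc : HasDerivAt (fun t : ℝ => H (x + t • v) (y + t • w)) c 0) :
    ∑ i, v i * dx i H x y + ∑ i, w i * dy i H x y = c := by
  have h1 : HasFDerivAt (fun p : (Fin d → ℝ) × (Fin d → ℝ) => H p.1 p.2)
      (fderiv ℝ (fun p : (Fin d → ℝ) × (Fin d → ℝ) => H p.1 p.2) (x, y))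
      (x + (0 : ℝ) • v, y + (0 : ℝ) • w) := by simpa using h.hasFDerivAt
  have h2 : HasDerivAt (fun t : ℝ => H (x + t • v) (y + t • w)) _ 0 :=
    HasFDerivAt.comp_hasDerivAt (l := fun p : (Fin d → ℝ) × (Fin d → ℝ) => H p.1 p.2)
      (f := fun t : ℝ => (x + t • v, y + t • w)) (0 : ℝ) h1
      ((hasDerivAt_line v x).prodMk (hasDerivAt_line w y))
  rw [← h2.unique hc]
  have hv : (v, w) = ∑ i, v i • ((Pi.single i 1, 0) : (Fin d → ℝ) × (Fin d → ℝ))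
      + ∑ i, w i • ((0, Pi.single i 1) : (Fin d → ℝ) × (Fin d → ℝ)) := by
    ext i <;> simp [Prod.fst_sum, Prod.snd_sum, Pi.single_apply]
  rw [hv, map_add, map_sum, map_sum]
  simp only [map_smul, smul_eq_mul, dx_eq_fderiv _ h, dy_eq_fderiv _ h]

theorem hasDerivAt_comp_curve {X Y : ℝ → Fin d → ℝ} {t : ℝ} {v w : Fin d → ℝ}
    (h : DifferentiableAt ℝ (fun p : (Fin d → ℝ) × (Fin d → ℝ) => H p.1 p.2) (X t, Y t))
    (hX : HasDerivAt X v t) (hY : HasDerivAt Y w t) :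
    HasDerivAt (fun τ => H (X τ) (Y τ))
      (fderiv ℝ (fun p : (Fin d → ℝ) × (Fin d → ℝ) => H p.1 p.2) (X t, Y t) (v, w)) t :=
  HasFDerivAt.comp_hasDerivAt (l := fun p : (Fin d → ℝ) × (Fin d → ℝ) => H p.1 p.2)
    (f := fun τ => (X τ, Y τ)) t h.hasFDerivAt (hX.prodMk hY)

/-- Allows closed formulas that are valid only on an open set, such as the slit bundle over `|W| <
1`, to be differentiated. -/
theorem dx_congr (hO : IsOpen O) (h : ∀ p ∈ O, H p.1 p.2 = K p.1 p.2) (hp : (x, y) ∈ O)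
    (i : Fin d) : dx i H x y = dx i K x y := by
  unfold dx partialDeriv
  rw [Filter.EventuallyEq.fderiv_eq]
  have : ∀ᶠ z in nhds x, (z, y) ∈ O :=
    (Continuous.prodMk_left y).continuousAt.eventually (hO.mem_nhds hp)
  filter_upwards [this] with z hz using h _ hz

theorem dy_congr (hO : IsOpen O) (h : ∀ p ∈ O, H p.1 p.2 = K p.1 p.2) (hp : (x, y) ∈ O)
    (i : Fin d) : dy i H x y = dy i K x y := by
  unfold dy partialDeriv
  rw [Filter.EventuallyEq.fderiv_eq]
  have : ∀ᶠ z in nhds y, (x, z) ∈ O :=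
    (Continuous.prodMk_right x).continuousAt.eventually (hO.mem_nhds hp)
  filter_upwards [this] with z hz using h _ hz

theorem contDiffOn_dy (hO : IsOpen O)
    (h : ContDiffOn ℝ ∞ (fun p : (Fin d → ℝ) × (Fin d → ℝ) => H p.1 p.2) O) (i : Fin d) :
    ContDiffOn ℝ ∞ (fun p : (Fin d → ℝ) × (Fin d → ℝ) => dy i H p.1 p.2) O := by
  have h1 := h.fderiv_of_isOpen hO (m := ∞) (by simp)
  refine (h1.clm_apply (contDiffOn_const (c := (0, Pi.single i 1)))).congr fun p hp => ?_
  exact dy_eq_fderiv i ((h.differentiableOn (by simp)).differentiableAt (hO.mem_nhds hp))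

theorem hasDerivAt_dotProduct {X Y : ℝ → Fin d → ℝ} {t : ℝ} {v w : Fin d → ℝ}
    (hX : HasDerivAt X v t) (hY : HasDerivAt Y w t) :
    HasDerivAt (fun τ => X τ ⬝ᵥ Y τ) (v ⬝ᵥ Y t + X t ⬝ᵥ w) t := by
  simp only [dotProduct, ← Finset.sum_add_distrib]
  exact HasDerivAt.fun_sum fun i _ => (hasDerivAt_pi.1 hX i).mul (hasDerivAt_pi.1 hY i)

theorem hasDerivAt_mulVec (A : Matrix (Fin d) (Fin d) ℝ) {X : ℝ → Fin d → ℝ} {t : ℝ}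
    {v : Fin d → ℝ} (hX : HasDerivAt X v t) :
    HasDerivAt (fun τ => A.mulVec (X τ)) (A.mulVec v) t :=
  hasDerivAt_pi.2 fun i => by
    simpa [Matrix.mulVec] using hasDerivAt_dotProduct (hasDerivAt_const t (A i)) hX

end Calculus

/-! ### Randers metrics from navigation data `(g, W)`. -/

section NavigationMetric

open Matrix

variable {d : ℕ}

/-- The bilinear form `A_{ij} v^i w^j` of a matrix. -/
def pairing (A : Matrix (Fin d) (Fin d) ℝ) (v w : Fin d → ℝ) : ℝ := v ⬝ᵥ A *ᵥ w

section Pairing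

variable (A : Matrix (Fin d) (Fin d) ℝ) (u v w : Fin d → ℝ) (c : ℝ)

theorem pairing_add_right : pairing A u (v + w) = pairing A u v + pairing A u w := by
  simp [pairing, mulVec_add]

theorem pairing_sub_left : pairing A (u - v) w = pairing A u w - pairing A v w := by
  simp [pairing]

theorem pairing_sub_right : pairing A u (v - w) = pairing A u v - pairing A u w := by
  simp [pairing, mulVec_sub]

theorem pairing_smul_left : pairing A (c • v) w = c * pairing A v w := by
  simp [pairing]

theorem pairing_smul_right : pairing A v (c • w) = c * pairing A v w := by
  simp [pairing, mulVec_smul]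

variable {A}

theorem pairing_comm (hA : A.IsHermitian) : pairing A v w = pairing A w v := by
  have hT : Aᵀ = A := by ext i j; simpa using hA.apply i j
  rw [pairing, dotProduct_mulVec, dotProduct_comm, ← mulVec_transpose, hT, pairing]

theorem pairing_self_pos (hA : A.PosDef) {v : Fin d → ℝ} (hv : v ≠ 0) : 0 < pairing A v v := by
  simpa [pairing] using hA.dotProduct_mulVec_pos hv

theorem pairing_self_nonneg (hA : A.PosDef) : 0 ≤ pairing A v v := by
  simpa [pairing] using hA.posSemidef.dotProduct_mulVec_nonneg v

end Pairing

theorem hasDerivAt_pairing (A : Matrix (Fin d) (Fin d) ℝ) {X Y : ℝ → Fin d → ℝ} {t : ℝ}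
    {v w : Fin d → ℝ} (hX : HasDerivAt X v t) (hY : HasDerivAt Y w t) :
    HasDerivAt (fun τ => pairing A (X τ) (Y τ)) (pairing A v (Y t) + pairing A (X t) w) t :=
  hasDerivAt_dotProduct hX (hasDerivAt_mulVec A hY)

variable {g : (Fin d → ℝ) → Matrix (Fin d) (Fin d) ℝ} {W : (Fin d → ℝ) → Fin d → ℝ}
  {x y : Fin d → ℝ} {U : Set (Fin d → ℝ)}

theorem lowered_eq : lowered g W x = g x *ᵥ W x := rfl

theorem normSq_eq : normSq g W x = pairing (g x) (W x) (W x) := by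
  rw [pairing, dotProduct_comm]; rfl

theorem sum_lowered_mul : ∑ i, lowered g W x i * y i = pairing (g x) y (W x) := by
  rw [pairing, dotProduct_comm]; rfl

theorem sum_mul_mul_eq_pairing (A : Matrix (Fin d) (Fin d) ℝ) (v w : Fin d → ℝ) :
    ∑ i, ∑ j, A i j * v i * w j = pairing A v w := by
  simp only [pairing, dotProduct, mulVec, Finset.mul_sum]
  exact Finset.sum_congr rfl fun i _ => Finset.sum_congr rfl fun j _ => by ring

theorem pairing_navA (v w : Fin d → ℝ) : pairing (navA g W x) v w =
    pairing (g x) v w / navLambda g W x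
      + pairing (g x) v (W x) * pairing (g x) w (W x) / navLambda g W x ^ 2 := by
  have h : navA g W x = (navLambda g W x)⁻¹ • g x
      + (navLambda g W x ^ 2)⁻¹ • vecMulVec (lowered g W x) (lowered g W x) := by
    ext i j
    simp [navA, vecMulVec_apply, div_eq_inv_mul]
  rw [pairing, h, add_mulVec, smul_mulVec, smul_mulVec, vecMulVec_mulVec, lowered_eq]
  simp only [dotProduct_add, dotProduct_smul, smul_eq_mul, pairing, dotProduct_comm _ w]
  simp
  ring

theorem navB_eq : navB g W x = -((navLambda g W x)⁻¹ • (g x *ᵥ W x)) := by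
  ext i; simp [navB, lowered_eq, div_eq_inv_mul]

/-- The radicand `λ |y|² + ⟨y, W⟩²`. -/
def navDisc (g : (Fin d → ℝ) → Matrix (Fin d) (Fin d) ℝ) (W : (Fin d → ℝ) → Fin d → ℝ)
    (x y : Fin d → ℝ) : ℝ :=
  navLambda g W x * pairing (g x) y y + pairing (g x) y (W x) ^ 2

/-- This is the larger root of `λ F² + 2 ⟨y, W⟩ F - |y|² = 0`, which is the equation `|y - F W|² =
F²` expanded. -/
theorem navigationMetric_eq (hW : normSq g W x < 1) : navigationMetric g W x y =
    (√(navDisc g W x y) - pairing (g x) y (W x)) / navLambda g W x := by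
  have hl : 0 < navLambda g W x := by unfold navLambda; linarith
  have hb : ∑ i, navB g W x i * y i = -(pairing (g x) y (W x) / navLambda g W x) := by
    rw [← sum_lowered_mul, Finset.sum_div, ← Finset.sum_neg_distrib]
    exact Finset.sum_congr rfl fun i _ => by simp only [navB]; ring
  have ha : pairing (g x) y y / navLambda g W x
      + pairing (g x) y (W x) * pairing (g x) y (W x) / navLambda g W x ^ 2
      = navDisc g W x y / navLambda g W x ^ 2 := by
    unfold navDisc; field_simp
  rw [navigationMetric, alphaPlusBeta, sum_mul_mul_eq_pairing, hb, pairing_navA, ha,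
    Real.sqrt_div' _ (by positivity), Real.sqrt_sq hl.le]
  ring

variable (g W) in
/-- The vector `y - F W`, whose `g`-norm is `F`. -/
def navShift (x y : Fin d → ℝ) : Fin d → ℝ := y - navigationMetric g W x y • W x

variable (g W) in
/-- The common denominator `F + ⟨y - F W, W⟩` of the first derivatives of `F`. -/
def navDenom (x y : Fin d → ℝ) : ℝ :=
  navigationMetric g W x y + pairing (g x) (navShift g W x y) (W x)

theorem navDisc_nonneg (hg : (g x).PosDef) (hW : normSq g W x < 1) : 0 ≤ navDisc g W x y :=
  add_nonneg (mul_nonneg (by unfold navLambda; linarith) (pairing_self_nonneg y hg)) (sq_nonneg _)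

theorem navDisc_pos (hg : (g x).PosDef) (hW : normSq g W x < 1) (hy : y ≠ 0) :
    0 < navDisc g W x y :=
  add_pos_of_pos_of_nonneg (mul_pos (by unfold navLambda; linarith) (pairing_self_pos hg hy))
    (sq_nonneg _)

/-- The denominator equals `λ F + ⟨y, W⟩`, which is the square root in the solution of the quadratic
equation. In particular it is nonzero for `y ≠ 0`. -/
theorem navDenom_eq (hW : normSq g W x < 1) : navDenom g W x y = √(navDisc g W x y) := by
  have hl : navLambda g W x ≠ 0 := by unfold navLambda; linarith
  have hn : pairing (g x) (W x) (W x) = 1 - navLambda g W x := by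
    rw [← normSq_eq]; unfold navLambda; ring
  rw [navDenom, navShift, pairing_sub_left, pairing_smul_left, hn, navigationMetric_eq hW]
  field_simp
  ring

theorem navDenom_pos (hg : (g x).PosDef) (hW : normSq g W x < 1) (hy : y ≠ 0) :
    0 < navDenom g W x y := by
  rw [navDenom_eq hW]; exact Real.sqrt_pos.2 (navDisc_pos hg hW hy)

/-- Zermelo's equation, from which the derivatives of `F` are obtained implicitly. -/
theorem pairing_navShift_self (hg : (g x).PosDef) (hW : normSq g W x < 1) :
    pairing (g x) (navShift g W x y) (navShift g W x y) = navigationMetric g W x y ^ 2 := by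
  have hl : navLambda g W x ≠ 0 := by unfold navLambda; linarith
  have hn : pairing (g x) (W x) (W x) = 1 - navLambda g W x := by
    rw [← normSq_eq]; unfold navLambda; ring
  have hs := Real.sq_sqrt (navDisc_nonneg (y := y) hg hW)
  rw [navShift, pairing_sub_left, pairing_sub_right, pairing_sub_right, pairing_smul_left,
    pairing_smul_right, pairing_smul_left, pairing_smul_right,
    pairing_comm (W x) y hg.isHermitian, hn, navigationMetric_eq hW]
  generalize √(navDisc g W x y) = s at *
  have hy : pairing (g x) y y = (s ^ 2 - pairing (g x) y (W x) ^ 2) / navLambda g W x := by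
    rw [hs, navDisc]; field_simp; ring
  rw [hy]
  field_simp
  ring

theorem navigationMetric_pos (hg : (g x).PosDef) (hW : normSq g W x < 1) (hy : y ≠ 0) :
    0 < navigationMetric g W x y := by
  have hl : 0 < navLambda g W x := by unfold navLambda; linarith
  rw [navigationMetric_eq hW]
  refine div_pos (sub_pos.2 (Real.lt_sqrt_of_sq_lt ?_)) hl
  rw [navDisc]
  have := mul_pos hl (pairing_self_pos hg hy)
  linarith

theorem navigationMetric_smul (hW : normSq g W x < 1) {c : ℝ} (hc : 0 < c) :
    navigationMetric g W x (c • y) = c * navigationMetric g W x y := by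
  have : navDisc g W x (c • y) = c ^ 2 * navDisc g W x y := by
    simp only [navDisc, pairing_smul_left, pairing_smul_right]; ring
  rw [navigationMetric_eq hW, navigationMetric_eq hW, this, Real.sqrt_mul (sq_nonneg c),
    Real.sqrt_sq hc.le, pairing_smul_left]
  ring

section Smooth

theorem contDiffOn_pairing {E : Type*} [NormedAddCommGroup E] [NormedSpace ℝ E] {s : Set E}
    {A : E → Matrix (Fin d) (Fin d) ℝ} {v w : E → Fin d → ℝ}
    (hA : ∀ i j, ContDiffOn ℝ ∞ (fun p => A p i j) s) (hv : ∀ i, ContDiffOn ℝ ∞ (fun p => v p i) s)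
    (hw : ∀ i, ContDiffOn ℝ ∞ (fun p => w p i) s) :
    ContDiffOn ℝ ∞ (fun p => pairing (A p) (v p) (w p)) s := by
  simp only [← sum_mul_mul_eq_pairing]
  exact ContDiffOn.sum fun i _ => ContDiffOn.sum fun j _ => ((hA i j).mul (hv i)).mul (hw j)

variable (hg : IsRiemannianMetric g U) (hWs : ∀ i, ContDiffOn ℝ ∞ (fun x => W x i) U)

include hg hWs

theorem contDiffOn_navLambda : ContDiffOn ℝ ∞ (navLambda g W) U := by
  unfold navLambda
  simp only [normSq_eq]
  exact contDiffOn_const.sub (contDiffOn_pairing hg.1 hWs hWs)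

theorem contDiffOn_lowered (i : Fin d) : ContDiffOn ℝ ∞ (fun x => lowered g W x i) U :=
  ContDiffOn.sum fun j _ => (hg.1 i j).mul (hWs j)

variable (hW : ∀ x ∈ U, normSq g W x < 1)

include hW

theorem contDiffOn_navigationMetric : ContDiffOn ℝ ∞
    (fun p : (Fin d → ℝ) × (Fin d → ℝ) => navigationMetric g W p.1 p.2)
    (U ×ˢ {y | y ≠ 0}) := by
  have hfst : Set.MapsTo Prod.fst (U ×ˢ {y : Fin d → ℝ | y ≠ 0}) U := fun p hp => hp.1
  have hg' : ∀ i j, ContDiffOn ℝ ∞ (fun p : (Fin d → ℝ) × (Fin d → ℝ) => g p.1 i j)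
      (U ×ˢ {y | y ≠ 0}) := fun i j => (hg.1 i j).comp contDiffOn_fst hfst
  have hW' : ∀ i, ContDiffOn ℝ ∞ (fun p : (Fin d → ℝ) × (Fin d → ℝ) => W p.1 i)
      (U ×ˢ {y | y ≠ 0}) := fun i => (hWs i).comp contDiffOn_fst hfst
  have hy : ∀ i, ContDiffOn ℝ ∞ (fun p : (Fin d → ℝ) × (Fin d → ℝ) => p.2 i)
      (U ×ˢ {y | y ≠ 0}) := fun i => by fun_prop
  have hl : ContDiffOn ℝ ∞ (fun p : (Fin d → ℝ) × (Fin d → ℝ) => navLambda g W p.1)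
      (U ×ˢ {y | y ≠ 0}) := (contDiffOn_navLambda hg hWs).comp contDiffOn_fst hfst
  have hyW := contDiffOn_pairing hg' hy hW'
  have hD : ContDiffOn ℝ ∞ (fun p : (Fin d → ℝ) × (Fin d → ℝ) => navDisc g W p.1 p.2)
      (U ×ˢ {y | y ≠ 0}) := (hl.mul (contDiffOn_pairing hg' hy hy)).add (hyW.pow 2)
  refine (((hD.sqrt fun p hp => (navDisc_pos (hg.2 _ hp.1) (hW _ hp.1) hp.2).ne').sub hyW).div hl
    fun p hp => ?_).congr fun p hp => navigationMetric_eq (hW _ hp.1)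
  have := hW _ hp.1
  unfold navLambda; linarith

theorem isRiemannianMetric_navA : IsRiemannianMetric (navA g W) U := by
  have hl0 : ∀ x ∈ U, 0 < navLambda g W x := fun x hx => by
    have := hW x hx
    unfold navLambda; linarith
  refine ⟨fun i j => ?_, fun x hx => ?_⟩
  · have hl := contDiffOn_navLambda hg hWs
    exact ((hg.1 i j).div hl fun x hx => (hl0 x hx).ne').add
      (((contDiffOn_lowered hg hWs i).mul (contDiffOn_lowered hg hWs j)).div (hl.pow 2)
        fun x hx => pow_ne_zero _ (hl0 x hx).ne')
  · refine PosDef.of_dotProduct_mulVec_pos ?_ fun v hv => ?_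
    · ext i j
      have h := (hg.2 x hx).isHermitian.apply i j
      simp only [star_trivial] at h
      simp [navA, h, mul_comm]
    · have h := pairing_navA (g := g) (W := W) (x := x) v v
      have h1 := pairing_self_pos (hg.2 x hx) hv
      have h2 := hl0 x hx
      rw [pairing] at h
      rw [star_trivial, h]
      have : 0 ≤ pairing (g x) v (W x) * pairing (g x) v (W x) / navLambda g W x ^ 2 :=
        div_nonneg (mul_self_nonneg _) (sq_nonneg _)
      positivity

/-- Since `b = A (-λ W)`, raising the index gives `-λ W`, and the squared norm of `b` is exactly
`|W|²`. -/
theorem norm_navB_lt_one (hx : x ∈ U) :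
    ∑ i, ∑ j, (navA g W x)⁻¹ i j * navB g W x i * navB g W x j < 1 := by
  have hl : navLambda g W x ≠ 0 := by
    have := hW x hx
    unfold navLambda; linarith
  have hA := (isRiemannianMetric_navA hg hWs hW).2 x hx
  have hn : pairing (g x) (W x) (W x) = 1 - navLambda g W x := by
    rw [← normSq_eq]; unfold navLambda; ring
  have hb : navB g W x = navA g W x *ᵥ (-(navLambda g W x) • W x) := by
    refine dotProduct_eq _ _ fun v => ?_
    rw [dotProduct_comm, dotProduct_comm _ v]
    change _ = pairing _ _ _
    rw [pairing_smul_right, pairing_navA, hn, navB_eq, dotProduct_neg, dotProduct_smul, ← pairing,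
      smul_eq_mul]
    field_simp
    ring
  have hdet : IsUnit (navA g W x).det := (isUnit_iff_isUnit_det _).1 hA.isUnit
  have hinv : (navA g W x)⁻¹ *ᵥ navB g W x = -(navLambda g W x) • W x := by
    rw [hb, mulVec_mulVec, nonsing_inv_mul _ hdet, one_mulVec]
  rw [sum_mul_mul_eq_pairing, pairing, hinv, navB_eq, dotProduct_smul, neg_dotProduct,
    smul_dotProduct, dotProduct_comm, ← pairing, ← normSq_eq, smul_eq_mul, smul_eq_mul]
  have := hW x hx
  field_simp
  linarith

end Smooth

section FibreDerivative

variable (hg : (g x).PosDef) (hW : normSq g W x < 1)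

include hg hW

theorem differentiableAt_navigationMetric_snd (hy : y ≠ 0) :
    DifferentiableAt ℝ (fun v => navigationMetric g W x v) y := by
  have hf : (fun v => navigationMetric g W x v) = fun v =>
      (√(navDisc g W x v) - pairing (g x) v (W x)) / navLambda g W x :=
    funext fun v => navigationMetric_eq hW
  have h1 : ∀ A : Matrix (Fin d) (Fin d) ℝ, ∀ w : (Fin d → ℝ) → Fin d → ℝ, Differentiable ℝ w →
      DifferentiableAt ℝ (fun v => pairing A v (w v)) y := fun A w hw => by
    simp only [← sum_mul_mul_eq_pairing]
    fun_prop
  rw [hf]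
  have hD : DifferentiableAt ℝ (fun v => navDisc g W x v) y :=
    ((h1 _ _ differentiable_id).const_mul _).add ((h1 _ _ (differentiable_const _)).pow 2)
  simp only [div_eq_mul_inv]
  exact ((hD.sqrt (navDisc_pos hg hW hy).ne').fun_sub
    (h1 _ _ (differentiable_const (W x)))).mul_const _

/-- Once a derivative `c` is known to exist, differentiating `⟨z, z⟩ = F²` gives `⟨z, w - c W⟩ = F
c`, which is linear in `c` with coefficient `D = F + ⟨z, W⟩`. -/
theorem hasDerivAt_navigationMetric_snd (hy : y ≠ 0) (w : Fin d → ℝ) :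
    HasDerivAt (fun t : ℝ => navigationMetric g W x (y + t • w))
      (pairing (g x) (navShift g W x y) w / navDenom g W x y) 0 := by
  obtain ⟨c, hc⟩ : ∃ c, HasDerivAt (fun t : ℝ => navigationMetric g W x (y + t • w)) c 0 := by
    have h1 : HasFDerivAt (fun v => navigationMetric g W x v)
        (fderiv ℝ (fun v => navigationMetric g W x v) y) (y + (0 : ℝ) • w) := by
      simpa using (differentiableAt_navigationMetric_snd hg hW hy).hasFDerivAt
    exact ⟨_, h1.comp_hasDerivAt (0 : ℝ) (hasDerivAt_line w y)⟩
  have hs : HasDerivAt (fun t : ℝ => navShift g W x (y + t • w)) (w - c • W x) 0 :=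
    (hasDerivAt_line w y).sub (hc.smul_const (W x))
  have h1 := hasDerivAt_pairing (g x) hs hs
  have h2 := (hc.fun_pow 2).congr_of_eventuallyEq (.of_forall fun t =>
    pairing_navShift_self (y := y + t • w) hg hW)
  have h3 := h1.unique h2
  simp only [zero_smul, add_zero, pairing_sub_left, pairing_sub_right, pairing_smul_left,
    pairing_smul_right, pairing_comm w _ hg.isHermitian,
    pairing_comm (W x) _ hg.isHermitian] at h3
  have hD := (navDenom_pos hg hW hy).ne'
  have : c = pairing (g x) (navShift g W x y) w / navDenom g W x y := by
    rw [eq_div_iff hD, navDenom]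
    norm_num at h3
    linarith
  rwa [← this]

theorem dy_navigationMetric (hy : y ≠ 0) (i : Fin d) : dy i (navigationMetric g W) x y =
    pairing (g x) (navShift g W x y) (Pi.single i 1) / navDenom g W x y :=
  partialDeriv_eq_of_hasDerivAt (differentiableAt_navigationMetric_snd hg hW hy)
    (hasDerivAt_navigationMetric_snd hg hW hy _)

theorem dy_sq_navigationMetric (hy : y ≠ 0) (i : Fin d) :
    dy i (fun x y => navigationMetric g W x y ^ 2) x y = 2 * navigationMetric g W x y *
      (pairing (g x) (navShift g W x y) (Pi.single i 1) / navDenom g W x y) := by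
  refine partialDeriv_eq_of_hasDerivAt
    ((differentiableAt_navigationMetric_snd hg hW hy).fun_pow 2) ?_
  simpa using (hasDerivAt_navigationMetric_snd hg hW hy (Pi.single i 1)).fun_pow 2

/-- The second derivative comes from differentiating the quotient `F ⟨z, e_j⟩ / D`, with `z` varying
by `e_i - F_i W`. The result is `F_i F_j` plus `F / D` times a form that Cauchy-Schwarz controls. -/
theorem fundamentalTensor_navigationMetric (hy : y ≠ 0) (i j : Fin d) :
    fundamentalTensor (navigationMetric g W) x y i j =
      dy i (navigationMetric g W) x y * dy j (navigationMetric g W) x y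
      + navigationMetric g W x y / navDenom g W x y *
        (pairing (g x) (Pi.single i 1 - dy i (navigationMetric g W) x y • W x)
            (Pi.single j 1 - dy j (navigationMetric g W) x y • W x)
          - dy i (navigationMetric g W) x y * dy j (navigationMetric g W) x y) := by
  have hF := hasDerivAt_navigationMetric_snd hg hW hy (Pi.single i 1)
  have hD := (navDenom_pos hg hW hy).ne'
  have hFd : DifferentiableAt ℝ (fun v => navigationMetric g W x v) y :=
    differentiableAt_navigationMetric_snd hg hW hy
  have hs : HasDerivAt (fun t : ℝ => navShift g W x (y + t • Pi.single i 1))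
      (Pi.single i 1 - dy i (navigationMetric g W) x y • W x) 0 := by
    rw [dy_navigationMetric hg hW hy]
    exact (hasDerivAt_line _ y).sub (hF.smul_const (W x))
  have hN := hasDerivAt_pairing (g x) hs (hasDerivAt_const (0 : ℝ) (Pi.single j (1 : ℝ)))
  have hDt := hF.fun_add (hasDerivAt_pairing (g x) hs (hasDerivAt_const (0 : ℝ) (W x)))
  have key : dy i (dy j fun x y => navigationMetric g W x y ^ 2) x y =
      dy i (fun x y => 2 * navigationMetric g W x y *
        (pairing (g x) (navShift g W x y) (Pi.single j 1) / navDenom g W x y)) x y := by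
    unfold dy partialDeriv
    rw [Filter.EventuallyEq.fderiv_eq]
    filter_upwards [isOpen_ne.mem_nhds hy] with v hv using dy_sq_navigationMetric hg hW hv j
  have hshift : ∀ k, DifferentiableAt ℝ (fun v => navShift g W x v k) y := fun k => by
    simp only [navShift, Pi.sub_apply, Pi.smul_apply, smul_eq_mul]
    fun_prop
  have hpair : ∀ z : Fin d → ℝ,
      DifferentiableAt ℝ (fun v => pairing (g x) (navShift g W x v) z) y := fun z => by
    simp only [← sum_mul_mul_eq_pairing]
    fun_prop
  have hdenom : ∀ v, navigationMetric g W x v + pairing (g x) (navShift g W x v) (W x)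
      = navDenom g W x v := fun _ => rfl
  simp only [hdenom] at hDt
  have hDd : DifferentiableAt ℝ (fun v => navDenom g W x v) y := hFd.fun_add (hpair _)
  have hcalc := partialDeriv_eq_of_hasDerivAt (i := i) (z := y)
    (h := fun v => 2 * navigationMetric g W x v *
        (pairing (g x) (navShift g W x v) (Pi.single j 1) / navDenom g W x v))
    ((hFd.const_mul 2).mul (by simpa only [div_eq_mul_inv] using (hpair (Pi.single j 1)).fun_mul (hDd.fun_inv hD)))
    ((hF.const_mul 2).mul (hN.fun_div hDt (by simpa using hD)))
  rw [fundamentalTensor, of_apply, key, dy, hcalc]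
  have hz : pairing (g x) (navShift g W x y) 0 = 0 := by simp [pairing]
  simp only [zero_smul, add_zero, hz, ← dy_navigationMetric hg hW hy]
  have hj : pairing (g x) (navShift g W x y) (Pi.single j 1) =
    dy j (navigationMetric g W) x y * navDenom g W x y := by
    rw [dy_navigationMetric hg hW hy]; field_simp
  rw [hj]
  simp only [pairing_sub_left, pairing_sub_right, pairing_smul_left, pairing_smul_right]
  field_simp
  ring

/-- With `q = dF(w)` the quadratic form is `q² + (F / D) (|w - q W|² - q²)`. Because `⟨z, w - q W⟩ =
F q` and `|z| = F`, Cauchy-Schwarz makes the bracket nonnegative. This is strict through `q²` if `q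
≠ 0`, and through `|w|²` if `q = 0`. -/
theorem posDef_fundamentalTensor_navigationMetric (hy : y ≠ 0) :
    (fundamentalTensor (navigationMetric g W) x y).PosDef := by
  set F := navigationMetric g W x y with hF
  set D := navDenom g W x y with hDdef
  set z := navShift g W x y with hz
  set p : Fin d → ℝ := fun i => dy i (navigationMetric g W) x y with hp
  have hF0 : 0 < F := navigationMetric_pos hg hW hy
  have hD0 : 0 < D := navDenom_pos hg hW hy
  have hT : fundamentalTensor (navigationMetric g W) x y =
      (1 + F / D * (pairing (g x) (W x) (W x) - 1)) • vecMulVec p p + (F / D) • g x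
        - (F / D) • vecMulVec p (g x *ᵥ W x) - (F / D) • vecMulVec (g x *ᵥ W x) p := by
    ext i j
    rw [fundamentalTensor_navigationMetric hg hW hy]
    have h1 : pairing (g x) (Pi.single i 1) (Pi.single j 1) = g x i j := by simp [pairing]
    have h2 : ∀ i, pairing (g x) (Pi.single i 1) (W x) = (g x *ᵥ W x) i := fun i => by
      simp [pairing]
    simp only [pairing_sub_left, pairing_sub_right, pairing_smul_left, pairing_smul_right,
      pairing_comm (W x) (Pi.single j 1) hg.isHermitian, h1, h2, Matrix.sub_apply, Matrix.add_apply,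
      Matrix.smul_apply,
      vecMulVec_apply, smul_eq_mul, hp, ← hF, ← hDdef]
    ring
  have hpp : p = D⁻¹ • (g x *ᵥ z) := by
    ext i
    simp only [hp, dy_navigationMetric hg hW hy, Pi.smul_apply, smul_eq_mul]
    rw [pairing_comm _ _ hg.isHermitian, pairing, single_one_dotProduct, div_eq_inv_mul]
  refine PosDef.of_dotProduct_mulVec_pos ?_ fun w hw => ?_
  · rw [hT]
    ext i j
    have h := hg.isHermitian.apply i j
    simp only [star_trivial] at h
    simp only [conjTranspose_apply, star_trivial, Matrix.sub_apply, Matrix.add_apply,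
      Matrix.smul_apply,
      vecMulVec_apply, smul_eq_mul, h]
    ring
  · have hpw : p ⬝ᵥ w * D = pairing (g x) z w := by
      rw [hpp, smul_dotProduct, dotProduct_comm, ← pairing, pairing_comm _ _ hg.isHermitian,
        smul_eq_mul]
      field_simp
    set q := p ⬝ᵥ w with hq
    have hquad : star w ⬝ᵥ (fundamentalTensor (navigationMetric g W) x y *ᵥ w) =
        q ^ 2 + F / D * (pairing (g x) (w - q • W x) (w - q • W x) - q ^ 2) := by
      rw [hT, star_trivial]
      simp only [sub_mulVec, add_mulVec, smul_mulVec, vecMulVec_mulVec, dotProduct_sub,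
        dotProduct_add, dotProduct_smul, ← hq]
      simp only [pairing_sub_left, pairing_sub_right, pairing_smul_left, pairing_smul_right,
        pairing_comm (W x) w hg.isHermitian]
      rw [dotProduct_comm w p, ← hq, dotProduct_comm (g x *ᵥ W x) w]
      simp only [pairing, smul_eq_mul, MulOpposite.smul_eq_mul_unop, MulOpposite.unop_op]
      ring
    have hzw : pairing (g x) z (w - q • W x) = F * q := by
      have : D = F + pairing (g x) z (W x) := rfl
      rw [pairing_sub_right, pairing_smul_right, ← hpw, this]; ring
    -- Cauchy-Schwarz as positivity of the squared norm of the component of `w - q W` orthogonal to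
    -- `z`; the coefficient is `⟨z, w - q W⟩ / |z|² = q / F`.
    have hcs : 0 ≤ pairing (g x) (w - q • W x - (q / F) • z) (w - q • W x - (q / F) • z) :=
      pairing_self_nonneg _ hg
    have hzz : pairing (g x) z z = F ^ 2 := pairing_navShift_self hg hW
    have hcs' : 0 ≤ pairing (g x) (w - q • W x) (w - q • W x) - q ^ 2 := by
      rw [pairing_sub_left, pairing_sub_right, pairing_sub_right _ ((q / F) • z),
        pairing_smul_left, pairing_smul_left, pairing_smul_right, pairing_smul_right,
        pairing_comm _ z hg.isHermitian, hzw, hzz] at hcs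
      field_simp at hcs
      linarith
    rw [hquad]
    rcases eq_or_ne q 0 with h0 | h0
    · have := pairing_self_pos hg hw
      simp only [h0, zero_smul, sub_zero]
      have := mul_pos (div_pos hF0 hD0) this
      simpa using this
    · have : 0 < q ^ 2 := by positivity
      have := mul_nonneg (div_pos hF0 hD0).le hcs'
      linarith

end FibreDerivative

theorem isRandersMetric_navigationMetric (hg : IsRiemannianMetric g U)
    (hWs : ∀ i, ContDiffOn ℝ ∞ (fun x => W x i) U) (hW : ∀ x ∈ U, normSq g W x < 1) :
    IsRandersMetric (navigationMetric g W) U := by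
  refine ⟨⟨contDiffOn_navigationMetric hg hWs hW,
    fun x hx y hy => navigationMetric_pos (hg.2 x hx) (hW x hx) hy,
    fun x hx y c hc => navigationMetric_smul (hW x hx) hc,
    fun x hx y hy => posDef_fundamentalTensor_navigationMetric (hg.2 x hx) (hW x hx) hy⟩,
    navA g W, navB g W, isRiemannianMetric_navA hg hWs hW, fun i => ?_,
    fun x hx => norm_navB_lt_one hg hWs hW hx, fun x _ y => rfl⟩
  refine (contDiffOn_lowered hg hWs i).neg.div (contDiffOn_navLambda hg hWs) fun x hx => ?_
  have := hW x hx
  unfold navLambda; linarith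

end NavigationMetric

/-! ### The Taub-NUT metric, its Levi-Civita connection and the Killing field `W`. -/

section TaubNUT

open Matrix

variable {a m n : ℝ} {x y v w p q : Fin 4 → ℝ}

section LinearFields

variable (m n v w) (c : ℝ)

theorem hopfForm_add : hopfForm (v + w) = hopfForm v + hopfForm w := by
  ext i; fin_cases i <;> simp [hopfForm] <;> ring

theorem hopfForm_smul : hopfForm (c • v) = c • hopfForm v := by
  ext i; fin_cases i <;> simp [hopfForm]

theorem hopfForm_hopfForm : hopfForm (hopfForm v) = -v := by
  ext i; fin_cases i <;> simp [hopfForm]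

theorem dotProduct_hopfForm : v ⬝ᵥ hopfForm w = -(hopfForm v ⬝ᵥ w) := by
  simp [hopfForm, dotProduct, Fin.sum_univ_four]; ring

theorem hopfForm_dotProduct_hopfForm : hopfForm v ⬝ᵥ hopfForm w = v ⬝ᵥ w := by
  simp [hopfForm, dotProduct, Fin.sum_univ_four]; ring

theorem hopfForm_dotProduct_self : hopfForm v ⬝ᵥ v = 0 := by
  simp [hopfForm, dotProduct, Fin.sum_univ_four]; ring

theorem rotationField_add :
    rotationField m n (v + w) = rotationField m n v + rotationField m n w := by
  ext i; fin_cases i <;> simp [rotationField] <;> ring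

theorem rotationField_sub :
    rotationField m n (v - w) = rotationField m n v - rotationField m n w := by
  ext i; fin_cases i <;> simp [rotationField] <;> ring

theorem rotationField_smul : rotationField m n (c • v) = c • rotationField m n v := by
  ext i; fin_cases i <;> simp [rotationField] <;> ring

theorem rotationField_zero : rotationField m n 0 = 0 := by
  ext i; fin_cases i <;> simp [rotationField]

theorem dotProduct_rotationField :
    v ⬝ᵥ rotationField m n w = -(rotationField m n v ⬝ᵥ w) := by
  simp [rotationField, dotProduct, Fin.sum_univ_four]; ring

theorem rotationField_dotProduct_self : rotationField m n v ⬝ᵥ v = 0 := by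
  simp [rotationField, dotProduct, Fin.sum_univ_four]; ring

/-- The commutation `J M = M J`, with the skewness of `M`, is what makes `W` Killing: `g_a` is built
only from the dot product and `J x`. -/
theorem hopfForm_rotationField :
    hopfForm (rotationField m n v) = rotationField m n (hopfForm v) := by
  ext i; fin_cases i <;> simp [rotationField, hopfForm]

theorem hasDerivAt_hopfForm {X : ℝ → Fin 4 → ℝ} {t : ℝ} (hX : HasDerivAt X v t) :
    HasDerivAt (fun τ => hopfForm (X τ)) (hopfForm v) t := by
  have h := hasDerivAt_pi.1 hX
  refine hasDerivAt_pi.2 fun i => ?_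
  fin_cases i
  · exact (h 1).fun_neg
  · exact h 0
  · exact (h 3).fun_neg
  · exact h 2

theorem hasDerivAt_rotationField {X : ℝ → Fin 4 → ℝ} {t : ℝ} (hX : HasDerivAt X v t) :
    HasDerivAt (fun τ => rotationField m n (X τ)) (rotationField m n v) t := by
  have h := hasDerivAt_pi.1 hX
  refine hasDerivAt_pi.2 fun i => ?_
  fin_cases i
  · exact (h 1).const_mul (-m)
  · exact (h 0).const_mul m
  · exact (h 3).const_mul (-n)
  · exact (h 2).const_mul n

end LinearFields

/-- The conformal factor `a |x|² + 1` of the Taub-NUT metric. -/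
def conf (a : ℝ) (x : Fin 4 → ℝ) : ℝ := a * (x ⬝ᵥ x) + 1

theorem euclSq_eq : euclSq x = x ⬝ᵥ x := by
  simp [euclSq, dotProduct, sq]

theorem dotProduct_self_nonneg' : 0 ≤ x ⬝ᵥ x := by
  simpa using dotProduct_star_self_nonneg x

theorem one_le_conf (ha : 0 < a) : 1 ≤ conf a x := by
  have := mul_nonneg ha.le (dotProduct_self_nonneg' (x := x))
  unfold conf; linarith

theorem conf_pos (ha : 0 < a) : 0 < conf a x := one_pos.trans_le (one_le_conf ha)

theorem mul_dotProduct_self : a * (x ⬝ᵥ x) = conf a x - 1 := by simp [conf]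

theorem pairing_taubNUT (ha : 0 < a) : pairing (taubNUT a x) v w = conf a x * (v ⬝ᵥ w)
    - (a + a * (conf a x)⁻¹) * (hopfForm x ⬝ᵥ v) * (hopfForm x ⬝ᵥ w) := by
  have h : taubNUT a x = conf a x • (1 : Matrix (Fin 4) (Fin 4) ℝ)
      - (a + a * (conf a x)⁻¹) • vecMulVec (hopfForm x) (hopfForm x) := by
    have hu := (conf_pos (x := x) ha).ne'
    have h1 : a * (a * euclSq x + 2) / (a * euclSq x + 1) = a + a * (conf a x)⁻¹ := by
      rw [euclSq_eq, mul_dotProduct_self, sub_add_cancel]; field_simp; ring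
    ext i j
    simp [taubNUT, vecMulVec_apply, h1]
    simp [conf, euclSq_eq]
  rw [pairing, h]
  simp only [sub_mulVec, smul_mulVec, one_mulVec, vecMulVec_mulVec, dotProduct_sub,
    dotProduct_smul, dotProduct_comm v (hopfForm x), smul_eq_mul, MulOpposite.smul_eq_mul_unop,
    MulOpposite.unop_op]
  ring

/-- With `u = 1 + a|x|²`, the identity `(a + a/u) |x|² = u - 1/u` and Cauchy-Schwarz bound the
metric below by `1/u` times the Euclidean one. -/
theorem posDef_taubNUT (ha : 0 < a) : (taubNUT a x).PosDef := by
  refine PosDef.of_dotProduct_mulVec_pos ?_ fun w hw => ?_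
  · ext i j
    simp [taubNUT, Matrix.one_apply, eq_comm, mul_comm (hopfForm x i)]
  · have hu := conf_pos (x := x) ha
    have hw' : 0 < w ⬝ᵥ w := by simpa using dotProduct_star_self_pos_iff.2 hw
    have hcs : (hopfForm x ⬝ᵥ w) ^ 2 ≤ (x ⬝ᵥ x) * (w ⬝ᵥ w) := by
      rw [← hopfForm_dotProduct_hopfForm x x]
      simpa [dotProduct, sq] using
        Finset.sum_mul_sq_le_sq_mul_sq Finset.univ (hopfForm x) w
    have h := pairing_taubNUT (x := x) (v := w) (w := w) ha
    rw [pairing] at h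
    rw [star_trivial, h]
    have h1 : (a + a * (conf a x)⁻¹) * (hopfForm x ⬝ᵥ w) ^ 2
        ≤ (a + a * (conf a x)⁻¹) * ((x ⬝ᵥ x) * (w ⬝ᵥ w)) := by gcongr
    have h2 : (a + a * (conf a x)⁻¹) * (x ⬝ᵥ x) = conf a x - (conf a x)⁻¹ := by
      rw [add_mul, mul_assoc, mul_comm (conf a x)⁻¹, ← mul_assoc, mul_dotProduct_self]
      field_simp; ring
    have h3 : 0 < (conf a x)⁻¹ * (w ⬝ᵥ w) := by positivity
    rw [← mul_assoc, h2] at h1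
    linarith

/-- The derivative of `g(p, q)` in the direction `v`, where `g` is the Taub-NUT metric. -/
def taubNUTDeriv (a : ℝ) (x v p q : Fin 4 → ℝ) : ℝ :=
  2 * a * (x ⬝ᵥ v) * (p ⬝ᵥ q)
    + 2 * a ^ 2 * (x ⬝ᵥ v) * (conf a x)⁻¹ ^ 2 * (hopfForm x ⬝ᵥ p) * (hopfForm x ⬝ᵥ q)
    - (a + a * (conf a x)⁻¹) *
      ((hopfForm v ⬝ᵥ p) * (hopfForm x ⬝ᵥ q) + (hopfForm x ⬝ᵥ p) * (hopfForm v ⬝ᵥ q))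

/-- The vector `Γ^i_{jk} v^j w^k` formed with the Christoffel symbols of the Taub-NUT metric. -/
def christoffel (a : ℝ) (x v w : Fin 4 → ℝ) : Fin 4 → ℝ :=
  -(conf a x)⁻¹ • (-(a * (x ⬝ᵥ v)) • w - (a * (x ⬝ᵥ w)) • v
    + (a ^ 2 * (conf a x)⁻¹ *
      ((x ⬝ᵥ v) * (hopfForm x ⬝ᵥ w) + (x ⬝ᵥ w) * (hopfForm x ⬝ᵥ v))) • hopfForm x
    + (a * (1 + (conf a x)⁻¹) * (hopfForm x ⬝ᵥ v)) • hopfForm w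
    + (a * (1 + (conf a x)⁻¹) * (hopfForm x ⬝ᵥ w)) • hopfForm v
    + (a * (v ⬝ᵥ w) + a ^ 2 * (conf a x)⁻¹ ^ 2 * (hopfForm x ⬝ᵥ v) * (hopfForm x ⬝ᵥ w)) • x)

theorem hasDerivAt_conf {X : ℝ → Fin 4 → ℝ} {t : ℝ} (hX : HasDerivAt X v t) :
    HasDerivAt (fun τ => conf a (X τ)) (2 * a * (X t ⬝ᵥ v)) t := by
  have h := ((hasDerivAt_dotProduct hX hX).const_mul a).add_const 1
  refine h.congr_deriv ?_
  rw [dotProduct_comm v]; ring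

theorem hasDerivAt_conf_inv (ha : 0 < a) {X : ℝ → Fin 4 → ℝ} {t : ℝ} (hX : HasDerivAt X v t) :
    HasDerivAt (fun τ => (conf a (X τ))⁻¹)
      (-(2 * a * (X t ⬝ᵥ v)) * (conf a (X t))⁻¹ ^ 2) t := by
  refine ((hasDerivAt_conf (a := a) hX).fun_inv (conf_pos ha).ne').congr_deriv ?_
  rw [inv_pow]; ring

theorem hasDerivAt_pairing_taubNUT (ha : 0 < a) {X P Q : ℝ → Fin 4 → ℝ} {t : ℝ}
    (hX : HasDerivAt X v t) (hP : HasDerivAt P p t) (hQ : HasDerivAt Q q t) :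
    HasDerivAt (fun τ => pairing (taubNUT a (X τ)) (P τ) (Q τ))
      (taubNUTDeriv a (X t) v (P t) (Q t) + pairing (taubNUT a (X t)) p (Q t)
        + pairing (taubNUT a (X t)) (P t) q) t := by
  simp only [pairing_taubNUT ha]
  have hJ := hasDerivAt_hopfForm v hX
  refine (((hasDerivAt_conf (a := a) hX).fun_mul (hasDerivAt_dotProduct hP hQ)).fun_sub
    (((((hasDerivAt_conf_inv ha hX).const_mul a).const_add a).fun_mul
      (hasDerivAt_dotProduct hJ hP)).fun_mul (hasDerivAt_dotProduct hJ hQ))).congr_deriv ?_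
  simp only [taubNUTDeriv]
  ring

section ChristoffelLinear

variable (a x v w)

theorem christoffel_add_right (z : Fin 4 → ℝ) :
    christoffel a x v (w + z) = christoffel a x v w + christoffel a x v z := by
  ext i
  simp only [christoffel, hopfForm_add, dotProduct_add, Pi.add_apply, Pi.sub_apply, Pi.smul_apply,
    smul_eq_mul]
  ring

theorem christoffel_smul_right (c : ℝ) :
    christoffel a x v (c • w) = c • christoffel a x v w := by
  ext i
  simp only [christoffel, hopfForm_smul, dotProduct_smul, Pi.add_apply, Pi.sub_apply,
    Pi.smul_apply, smul_eq_mul]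
  ring

theorem christoffel_comm : christoffel a x v w = christoffel a x w v := by
  ext i
  simp only [christoffel, dotProduct_comm w v, Pi.add_apply, Pi.sub_apply, Pi.smul_apply,
    smul_eq_mul]
  ring

theorem dotProduct_christoffel (z : Fin 4 → ℝ) : z ⬝ᵥ christoffel a x v w =
    -(conf a x)⁻¹ * (-(a * (x ⬝ᵥ v)) * (z ⬝ᵥ w) - (a * (x ⬝ᵥ w)) * (z ⬝ᵥ v)
    + (a ^ 2 * (conf a x)⁻¹ *
      ((x ⬝ᵥ v) * (hopfForm x ⬝ᵥ w) + (x ⬝ᵥ w) * (hopfForm x ⬝ᵥ v))) * (z ⬝ᵥ hopfForm x)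
    + (a * (1 + (conf a x)⁻¹) * (hopfForm x ⬝ᵥ v)) * (z ⬝ᵥ hopfForm w)
    + (a * (1 + (conf a x)⁻¹) * (hopfForm x ⬝ᵥ w)) * (z ⬝ᵥ hopfForm v)
    + (a * (v ⬝ᵥ w) + a ^ 2 * (conf a x)⁻¹ ^ 2 * (hopfForm x ⬝ᵥ v) * (hopfForm x ⬝ᵥ w))
      * (z ⬝ᵥ x)) := by
  simp only [christoffel, dotProduct_smul, dotProduct_add, dotProduct_sub, smul_eq_mul]

end ChristoffelLinear

/-- The metric sees a vector only through dot products and its component along `J x`, so this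
component is what lowering the index of `Γ` requires. Most terms vanish or combine because `a|x|² =
u - 1`. -/
theorem hopfForm_dotProduct_christoffel (ha : 0 < a) : hopfForm x ⬝ᵥ christoffel a x v w =
    -(a * (conf a x)⁻¹) *
      ((x ⬝ᵥ v) * (hopfForm x ⬝ᵥ w) + (x ⬝ᵥ w) * (hopfForm x ⬝ᵥ v)) := by
  have hu := (conf_pos (x := x) ha).ne'
  have hr := mul_dotProduct_self (a := a) (x := x)
  rw [dotProduct_christoffel]
  simp only [hopfForm_dotProduct_hopfForm, hopfForm_dotProduct_self]
  field_simp
  linear_combination (-conf a x * ((x ⬝ᵥ v) * (hopfForm x ⬝ᵥ w) + (x ⬝ᵥ w) * (hopfForm x ⬝ᵥ v))) * hr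

/-- The Levi-Civita connection of the Taub-NUT metric is compatible with the metric. -/
theorem taubNUTDeriv_eq (ha : 0 < a) : taubNUTDeriv a x w p q =
    pairing (taubNUT a x) (christoffel a x p w) q
      + pairing (taubNUT a x) p (christoffel a x q w) := by
  have hu := (conf_pos (x := x) ha).ne'
  rw [pairing_taubNUT ha, pairing_taubNUT ha, hopfForm_dotProduct_christoffel ha,
    hopfForm_dotProduct_christoffel ha, dotProduct_comm _ q, dotProduct_christoffel,
    dotProduct_christoffel, taubNUTDeriv]
  simp only [dotProduct_comm _ x, dotProduct_comm q p, dotProduct_comm q w,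
    dotProduct_comm p w, dotProduct_comm p (hopfForm _), dotProduct_comm q (hopfForm _)]
  have h5 : hopfForm p ⬝ᵥ q = -(hopfForm q ⬝ᵥ p) := by
    rw [dotProduct_comm, dotProduct_hopfForm]
  rw [h5]
  field_simp
  ring

/-- The Koszul formula on the diagonal, a consequence of metric compatibility and the symmetry of
`Γ`. It brings `Γ(z, z)` into the form that occurs in the Euler-Lagrange equations. -/
theorem pairing_christoffel_self (ha : 0 < a) :
    pairing (taubNUT a x) (christoffel a x v v) w =
      taubNUTDeriv a x v v w - taubNUTDeriv a x w v v / 2 := by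
  have hH := (posDef_taubNUT (x := x) ha).isHermitian
  rw [taubNUTDeriv_eq ha, taubNUTDeriv_eq ha, pairing_comm v (christoffel a x w v) hH,
    pairing_comm v _ hH, christoffel_comm a x w v]
  ring

/-- The rotation field is a Killing field of the Taub-NUT metric. -/
theorem taubNUTDeriv_rotationField (ha : 0 < a) :
    taubNUTDeriv a x (rotationField m n x) p q + pairing (taubNUT a x) (rotationField m n p) q
      + pairing (taubNUT a x) p (rotationField m n q) = 0 := by
  rw [pairing_taubNUT ha, pairing_taubNUT ha, taubNUTDeriv]
  simp only [hopfForm_rotationField, dotProduct_rotationField, rotationField_dotProduct_self]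
  ring

end TaubNUT

/-! ### Ricci flatness of the Taub-NUT metric. -/

section TaubNUTRicci

open Matrix

variable {a : ℝ} {x y v w : Fin 4 → ℝ}

/-- The matrix of the linear map `hopfForm`. -/
def hopfMatrix : Matrix (Fin 4) (Fin 4) ℝ := !![0, -1, 0, 0; 1, 0, 0, 0; 0, 0, 0, -1; 0, 0, 1, 0]

theorem hopfMatrix_mulVec : hopfMatrix *ᵥ v = hopfForm v := by
  ext i; fin_cases i <;> simp [hopfMatrix, hopfForm, mulVec, dotProduct, Fin.sum_univ_four]

theorem vecMul_hopfMatrix : v ᵥ* hopfMatrix = -hopfForm v := by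
  ext i; fin_cases i <;> simp [hopfMatrix, hopfForm, vecMul, dotProduct, Fin.sum_univ_four]

theorem hopfMatrix_mul_self : hopfMatrix * hopfMatrix = -1 := by
  ext i j
  rw [mul_apply, Fin.sum_univ_four]
  fin_cases i <;> fin_cases j <;> simp [hopfMatrix]

theorem trace_hopfMatrix : hopfMatrix.trace = 0 := by
  simp [trace, hopfMatrix, Fin.sum_univ_four]

variable (a x y) in
/-- The matrix `Γ^i_{jk} y^j` formed with the Christoffel symbols of the Taub-NUT metric. -/
def christoffelMatrix : Matrix (Fin 4) (Fin 4) ℝ :=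
  of fun i k => christoffel a x y (Pi.single k 1) i

/-- A combination of the identity, `J` and three rank-one matrices, so that traces of it and of its
square reduce to dot products. -/
theorem christoffelMatrix_eq : christoffelMatrix a x y =
    (a * (x ⬝ᵥ y) * (conf a x)⁻¹) • (1 : Matrix (Fin 4) (Fin 4) ℝ)
    - (a * (1 + (conf a x)⁻¹) * (hopfForm x ⬝ᵥ y) * (conf a x)⁻¹) • hopfMatrix
    + vecMulVec ((a * (conf a x)⁻¹) • y
        - (a ^ 2 * (hopfForm x ⬝ᵥ y) * (conf a x)⁻¹ ^ 2) • hopfForm x) x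
    - vecMulVec ((a ^ 2 * (x ⬝ᵥ y) * (conf a x)⁻¹ ^ 2) • hopfForm x
        + (a * (1 + (conf a x)⁻¹) * (conf a x)⁻¹) • hopfForm y
        + (a ^ 2 * (hopfForm x ⬝ᵥ y) * (conf a x)⁻¹ ^ 3) • x) (hopfForm x)
    - vecMulVec ((a * (conf a x)⁻¹) • x) y := by
  ext i k
  have h1 : (Pi.single k 1 : Fin 4 → ℝ) i = (1 : Matrix (Fin 4) (Fin 4) ℝ) i k := by
    simp [Pi.single_apply, Matrix.one_apply]
  have h2 : hopfForm (Pi.single k 1) i = hopfMatrix i k := by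
    rw [← hopfMatrix_mulVec]; simp
  simp only [christoffelMatrix, of_apply, christoffel, Pi.add_apply, Pi.sub_apply, Pi.smul_apply,
    smul_eq_mul, dotProduct_single_one, h1, h2, Matrix.add_apply, Matrix.sub_apply,
    Matrix.smul_apply, vecMulVec_apply]
  ring

theorem christoffelMatrix_mulVec : christoffelMatrix a x y *ᵥ v = christoffel a x y v := by
  have h : christoffelMatrix a x y *ᵥ v = ∑ k, v k • christoffel a x y (Pi.single k 1) := by
    ext i
    simp [mulVec, dotProduct, christoffelMatrix, mul_comm]
  have hv : v = ∑ k, v k • (Pi.single k 1 : Fin 4 → ℝ) := by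
    ext i; simp [Pi.single_apply]
  rw [h]
  conv_rhs => rw [hv]
  simp only [Fin.sum_univ_four, christoffel_add_right, christoffel_smul_right]

theorem hopfForm_dotProduct_of_comm : hopfForm y ⬝ᵥ x = -(hopfForm x ⬝ᵥ y) := by
  rw [dotProduct_comm, dotProduct_hopfForm]

/-- The trace is the logarithmic derivative of the volume density, and `√det g_a = 1 + a|x|²`: the
eigenvalues are `u` three times and `1/u` along `J x`. -/
theorem trace_christoffelMatrix (ha : 0 < a) :
    (christoffelMatrix a x y).trace = 2 * a * (x ⬝ᵥ y) * (conf a x)⁻¹ := by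
  have hu : (a * (x ⬝ᵥ x) + 1) * (conf a x)⁻¹ = 1 := mul_inv_cancel₀ (conf_pos ha).ne'
  rw [christoffelMatrix_eq]
  simp only [trace_add, trace_sub, trace_smul, trace_one, trace_hopfMatrix, trace_vecMulVec,
    add_dotProduct, sub_dotProduct, smul_dotProduct, hopfForm_dotProduct_hopfForm,
    hopfForm_dotProduct_self, smul_eq_mul, dotProduct_comm y x, dotProduct_comm x (hopfForm x),
    Fintype.card_fin]
  push_cast
  linear_combination (-(a * (x ⬝ᵥ y) * (conf a x)⁻¹)) * hu

/-- Rests only on `J² = -1`, `tr J = 0` and the skewness of `J`. Arbitrary vectors keep the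
expansion separate from the long coefficients of `Γ`. -/
theorem trace_rankOne_add_mul_self (α β : ℝ) (p₁ p₂ p₃ q₁ q₂ q₃ : Fin 4 → ℝ) :
    ((α • (1 : Matrix (Fin 4) (Fin 4) ℝ) - β • hopfMatrix + vecMulVec p₁ q₁ - vecMulVec p₂ q₂
      - vecMulVec p₃ q₃) * (α • (1 : Matrix (Fin 4) (Fin 4) ℝ) - β • hopfMatrix
      + vecMulVec p₁ q₁ - vecMulVec p₂ q₂ - vecMulVec p₃ q₃)).trace =
    4 * α ^ 2 - 4 * β ^ 2 + 2 * α * (q₁ ⬝ᵥ p₁ - q₂ ⬝ᵥ p₂ - q₃ ⬝ᵥ p₃)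
    + 2 * β * (hopfForm q₁ ⬝ᵥ p₁ - hopfForm q₂ ⬝ᵥ p₂ - hopfForm q₃ ⬝ᵥ p₃)
    + (q₁ ⬝ᵥ p₁) ^ 2 + (q₂ ⬝ᵥ p₂) ^ 2 + (q₃ ⬝ᵥ p₃) ^ 2 - 2 * (q₁ ⬝ᵥ p₂) * (q₂ ⬝ᵥ p₁)
    - 2 * (q₁ ⬝ᵥ p₃) * (q₃ ⬝ᵥ p₁) + 2 * (q₂ ⬝ᵥ p₃) * (q₃ ⬝ᵥ p₂) := by
  have hJ (p q : Fin 4 → ℝ) : hopfForm p ⬝ᵥ q = -(hopfForm q ⬝ᵥ p) := by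
    rw [dotProduct_comm, dotProduct_hopfForm]
  simp only [Matrix.mul_add, Matrix.add_mul, Matrix.mul_sub, Matrix.sub_mul, Matrix.smul_mul,
    Matrix.mul_smul, Matrix.mul_one, Matrix.one_mul, hopfMatrix_mul_self, vecMulVec_mul_vecMulVec]
  simp only [vecMulVec_mul, mul_vecMulVec, hopfMatrix_mulVec, vecMul_hopfMatrix, trace_add,
    trace_sub, trace_smul, trace_one, trace_neg, trace_hopfMatrix, trace_vecMulVec,
    vecMulVec_smul, neg_dotProduct, smul_neg, smul_eq_mul,
    hJ p₁, hJ p₂, hJ p₃, dotProduct_comm p₁, dotProduct_comm p₂, dotProduct_comm p₃,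
    Fintype.card_fin]
  push_cast
  ring

/-- The derivative of `Γ(y, y) / 2` in the direction `v` of the base point. -/
def christoffelDeriv (a : ℝ) (x v y : Fin 4 → ℝ) : Fin 4 → ℝ :=
  (a * (v ⬝ᵥ y) * (conf a x)⁻¹ - 2 * a ^ 2 * (x ⬝ᵥ y) * (x ⬝ᵥ v) * (conf a x)⁻¹ ^ 2) • y
  - (a ^ 2 * ((v ⬝ᵥ y) * (hopfForm x ⬝ᵥ y) + (x ⬝ᵥ y) * (hopfForm v ⬝ᵥ y)) * (conf a x)⁻¹ ^ 2
    - 4 * a ^ 3 * (x ⬝ᵥ y) * (hopfForm x ⬝ᵥ y) * (x ⬝ᵥ v) * (conf a x)⁻¹ ^ 3) • hopfForm x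
  - (a ^ 2 * (x ⬝ᵥ y) * (hopfForm x ⬝ᵥ y) * (conf a x)⁻¹ ^ 2) • hopfForm v
  - (a * (hopfForm v ⬝ᵥ y) * ((conf a x)⁻¹ + (conf a x)⁻¹ ^ 2)
    - 2 * a ^ 2 * (hopfForm x ⬝ᵥ y) * (x ⬝ᵥ v) *
      ((conf a x)⁻¹ ^ 2 + 2 * (conf a x)⁻¹ ^ 3)) • hopfForm y
  - (a ^ 2 * (hopfForm x ⬝ᵥ y) * (hopfForm v ⬝ᵥ y) * (conf a x)⁻¹ ^ 3
    - a ^ 2 * (y ⬝ᵥ y) * (x ⬝ᵥ v) * (conf a x)⁻¹ ^ 2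
    - 3 * a ^ 3 * (hopfForm x ⬝ᵥ y) ^ 2 * (x ⬝ᵥ v) * (conf a x)⁻¹ ^ 4) • x
  - (1 / 2 * (a * (y ⬝ᵥ y) * (conf a x)⁻¹
    + a ^ 2 * (hopfForm x ⬝ᵥ y) ^ 2 * (conf a x)⁻¹ ^ 3)) • v

theorem half_christoffel_self : (1 / 2 : ℝ) • christoffel a x y y =
    (a * (x ⬝ᵥ y) * (conf a x)⁻¹) • y
    - (a ^ 2 * (x ⬝ᵥ y) * (hopfForm x ⬝ᵥ y) * (conf a x)⁻¹ ^ 2) • hopfForm x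
    - (a * (hopfForm x ⬝ᵥ y) * ((conf a x)⁻¹ + (conf a x)⁻¹ ^ 2)) • hopfForm y
    - (1 / 2 * (a * (y ⬝ᵥ y) * (conf a x)⁻¹
      + a ^ 2 * (hopfForm x ⬝ᵥ y) ^ 2 * (conf a x)⁻¹ ^ 3)) • x := by
  ext i
  simp only [christoffel, Pi.add_apply, Pi.sub_apply, Pi.smul_apply, smul_eq_mul]
  ring

theorem hasDerivAt_half_christoffel (ha : 0 < a) {X Y : ℝ → Fin 4 → ℝ} {t : ℝ}
    (hX : HasDerivAt X v t) (hY : HasDerivAt Y w t) :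
    HasDerivAt (fun τ => (1 / 2 : ℝ) • christoffel a (X τ) (Y τ) (Y τ))
      (christoffelDeriv a (X t) v (Y t) + christoffel a (X t) (Y t) w) t := by
  have hU := hasDerivAt_conf_inv ha hX
  have hJ := hasDerivAt_hopfForm v hX
  have hJY := hasDerivAt_hopfForm w hY
  have hτ := hasDerivAt_dotProduct hX hY
  have ht := hasDerivAt_dotProduct hJ hY
  have hq := hasDerivAt_dotProduct hY hY
  simp only [half_christoffel_self]
  refine ((((((hτ.const_mul a).fun_mul hU).fun_smul hY).fun_sub
    ((((hτ.const_mul (a ^ 2)).fun_mul ht).fun_mul (hU.fun_pow 2)).fun_smul hJ)).fun_sub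
    (((ht.const_mul a).fun_mul (hU.fun_add (hU.fun_pow 2))).fun_smul hJY)).fun_sub
    (((((hq.const_mul a).fun_mul hU).fun_add
      (((ht.fun_pow 2).const_mul (a ^ 2)).fun_mul (hU.fun_pow 3))).const_mul
        (1 / 2)).fun_smul hX)).congr_deriv ?_
  ext i
  simp only [christoffel, christoffelDeriv, Pi.add_apply, Pi.sub_apply, Pi.smul_apply, smul_eq_mul,
    dotProduct_comm w]
  norm_num
  ring

theorem sum_christoffelDeriv : ∑ k, christoffelDeriv a x (Pi.single k 1) y k =
    a * (y ⬝ᵥ y) * (conf a x)⁻¹ ^ 2 * (1 + a * (x ⬝ᵥ x))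
    - a ^ 2 * (x ⬝ᵥ y) ^ 2 * (conf a x)⁻¹ ^ 2
    - 3 * a ^ 2 * (hopfForm x ⬝ᵥ y) ^ 2 * ((conf a x)⁻¹ ^ 2 + (conf a x)⁻¹ ^ 3)
    - 4 * a ^ 2 * (hopfForm x ⬝ᵥ y) ^ 2 * (conf a x)⁻¹ ^ 3
    + 3 * a ^ 3 * (hopfForm x ⬝ᵥ y) ^ 2 * (x ⬝ᵥ x) * (conf a x)⁻¹ ^ 4 := by
  generalize hU : (conf a x)⁻¹ = U
  simp only [christoffelDeriv, Pi.sub_apply, Pi.smul_apply, smul_eq_mul, hU, Fin.sum_univ_four, hopfForm, dotProduct]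
  simp
  ring

/-- The Taub-NUT metric is Ricci flat. -/
theorem taubNUT_ricci_flat (ha : 0 < a) :
    2 * ∑ k, christoffelDeriv a x (Pi.single k 1) y k
      - (christoffelMatrix a x y * christoffelMatrix a x y).trace
      - 2 * a * (y ⬝ᵥ y) * (conf a x)⁻¹ + 4 * a ^ 2 * (x ⬝ᵥ y) ^ 2 * (conf a x)⁻¹ ^ 2
      + 4 * a * (conf a x)⁻¹ * (x ⬝ᵥ (1 / 2 : ℝ) • christoffel a x y y) = 0 := by
  rw [christoffelMatrix_eq, trace_rankOne_add_mul_self, sum_christoffelDeriv, half_christoffel_self]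
  simp only [dotProduct_add, dotProduct_sub, dotProduct_smul, smul_eq_mul,
    hopfForm_hopfForm, neg_dotProduct, dotProduct_hopfForm, hopfForm_dotProduct_self,
    dotProduct_comm y x, dotProduct_comm x (hopfForm x),
    hopfForm_dotProduct_of_comm (x := x) (y := y)]
  have hu := (conf_pos (x := x) ha).ne'
  -- Eliminating `|x|²` leaves a rational identity in `a`, `u` and the scalars `x·y`, `y·y`, `Jx·y`.
  have hr : x ⬝ᵥ x = (conf a x - 1) / a := by rw [← mul_dotProduct_self]; field_simp
  rw [hr]
  generalize conf a x = u at *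
  generalize x ⬝ᵥ y = τ
  generalize y ⬝ᵥ y = q
  generalize hopfForm x ⬝ᵥ y = t
  field_simp
  ring

end TaubNUTRicci

/-! ### The spray of the Randers metric. -/

section Spray

open Matrix

/-- The geodesic coefficients are determined by the Euler-Lagrange equations of `F²`. -/
theorem geodesicCoeff_eq_of_posDef {d : ℕ} {F : (Fin d → ℝ) → (Fin d → ℝ) → ℝ} {x y : Fin d → ℝ}
    (hF : (fundamentalTensor F x y).PosDef) (G : Fin d → ℝ)
    (hG : ∀ l, ∑ k, y k * dx k (dy l fun x y => F x y ^ 2) x y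
      + ∑ k, (-2 * G k) * dy k (dy l fun x y => F x y ^ 2) x y = dx l (fun x y => F x y ^ 2) x y)
    (i : Fin d) : geodesicCoeff F i x y = G i := by
  have hdet : IsUnit (fundamentalTensor F x y).det := (isUnit_iff_isUnit_det _).1 hF.isUnit
  -- The factor `4` is `2` from `-2G` and `2` from the `½` in the fundamental tensor; it cancels the
  -- `¼` in the definition of `G`.
  have h1 : ∀ l, (∑ k, dx k (dy l fun x y => F x y ^ 2) x y * y k)
      - dx l (fun x y => F x y ^ 2) x y = 4 * (fundamentalTensor F x y *ᵥ G) l := fun l => by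
    have h2 : (fundamentalTensor F x y *ᵥ G) l
        = ∑ k, 1 / 2 * G k * dy k (dy l fun x y => F x y ^ 2) x y := by
      rw [mulVec, dotProduct]
      refine Finset.sum_congr rfl fun k _ => ?_
      rw [← hF.isHermitian.apply l k, star_trivial, fundamentalTensor, of_apply]
      ring
    rw [h2, ← hG l, Finset.mul_sum, ← sub_sub, ← Finset.sum_sub_distrib, ← Finset.sum_sub_distrib]
    exact Finset.sum_congr rfl fun k _ => by ring
  have h3 : (1 / 4 : ℝ) * ∑ l, (fundamentalTensor F x y)⁻¹ i l *
      (4 * (fundamentalTensor F x y *ᵥ G) l) =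
      ((fundamentalTensor F x y)⁻¹ *ᵥ (fundamentalTensor F x y *ᵥ G)) i := by
    rw [mulVec, dotProduct, Finset.mul_sum]
    exact Finset.sum_congr rfl fun l _ => by ring
  simp only [geodesicCoeff, h1]
  rw [h3, mulVec_mulVec, nonsing_inv_mul _ hdet, one_mulVec]

variable {a m n : ℝ} {x y v w : Fin 4 → ℝ}

theorem isRiemannianMetric_taubNUT (ha : 0 < a) (U : Set (Fin 4 → ℝ)) :
    IsRiemannianMetric (taubNUT a) U := by
  refine ⟨fun i j => ContDiff.contDiffOn ?_, fun x _ => posDef_taubNUT ha⟩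
  have he : ContDiff ℝ ∞ euclSq := by unfold euclSq; fun_prop
  have hj : ∀ i, ContDiff ℝ ∞ fun x => hopfForm x i := fun i => by
    fin_cases i <;> simp [hopfForm] <;> fun_prop
  have hi := hj i
  have hj := hj j
  simp only [taubNUT, of_apply]
  refine ContDiff.sub (by fun_prop) (ContDiff.mul (ContDiff.div (by fun_prop) (by fun_prop)
    fun x => ?_) (by fun_prop))
  rw [euclSq_eq]; exact (conf_pos ha).ne'

theorem contDiff_rotationField (i : Fin 4) : ContDiff ℝ ∞ fun x => rotationField m n x i := by
  fin_cases i <;> simp [rotationField] <;> fun_prop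

variable (a m n) in
/-- The region where `|W| < 1`. -/
def mildRegion : Set (Fin 4 → ℝ) := {x | normSq (taubNUT a) (rotationField m n) x < 1}

theorem isOpen_mildRegion (ha : 0 < a) : IsOpen (mildRegion a m n) := by
  have h : ContDiffOn ℝ ∞ (normSq (taubNUT a) (rotationField m n)) Set.univ := by
    have h1 := contDiffOn_pairing (isRiemannianMetric_taubNUT ha Set.univ).1
      (fun i => (contDiff_rotationField (m := m) (n := n) i).contDiffOn)
      (fun i => (contDiff_rotationField (m := m) (n := n) i).contDiffOn)
    simpa only [← normSq_eq] using h1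
  exact isOpen_lt (contDiffOn_univ.1 h).continuous continuous_const

theorem isRandersMetric_taubNUTRanders (ha : 0 < a) :
    IsRandersMetric (taubNUTRanders a m n) (mildRegion a m n) :=
  isRandersMetric_navigationMetric (isRiemannianMetric_taubNUT ha _)
    (fun i => (contDiff_rotationField i).contDiffOn) fun _ hx => hx

variable (a m n) in
/-- The slit tangent bundle of the region where `|W| < 1`. -/
def slitBundle : Set ((Fin 4 → ℝ) × (Fin 4 → ℝ)) := mildRegion a m n ×ˢ {y | y ≠ 0}

theorem isOpen_slitBundle (ha : 0 < a) : IsOpen (slitBundle a m n) :=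
  (isOpen_mildRegion ha).prod isOpen_ne

theorem contDiffOn_taubNUTRanders (ha : 0 < a) : ContDiffOn ℝ ∞
    (fun p : (Fin 4 → ℝ) × (Fin 4 → ℝ) => taubNUTRanders a m n p.1 p.2) (slitBundle a m n) :=
  (isRandersMetric_taubNUTRanders ha).1.smooth

theorem differentiableAt_of_contDiffOn (ha : 0 < a) {H : (Fin 4 → ℝ) → (Fin 4 → ℝ) → ℝ}
    (hH : ContDiffOn ℝ ∞ (fun p : (Fin 4 → ℝ) × (Fin 4 → ℝ) => H p.1 p.2) (slitBundle a m n))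
    (hp : (x, y) ∈ slitBundle a m n) :
    DifferentiableAt ℝ (fun p : (Fin 4 → ℝ) × (Fin 4 → ℝ) => H p.1 p.2) (x, y) :=
  (hH.differentiableOn (by simp)).differentiableAt ((isOpen_slitBundle ha).mem_nhds hp)

variable (a m n) in
/-- The vector `y - F W` for the Taub-NUT navigation data. -/
abbrev shift (x y : Fin 4 → ℝ) : Fin 4 → ℝ := navShift (taubNUT a) (rotationField m n) x y

variable (a m n) in
/-- The denominator `F + ⟨y - F W, W⟩` for the Taub-NUT navigation data. -/
abbrev denom (x y : Fin 4 → ℝ) : ℝ := navDenom (taubNUT a) (rotationField m n) x y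

theorem shift_eq : shift a m n x y = y - taubNUTRanders a m n x y • rotationField m n x := rfl

theorem denom_pos (ha : 0 < a) (hp : (x, y) ∈ slitBundle a m n) : 0 < denom a m n x y :=
  navDenom_pos (posDef_taubNUT ha) hp.1 hp.2

theorem hasDerivAt_taubNUTRanders (ha : 0 < a) {X Y : ℝ → Fin 4 → ℝ} {t : ℝ}
    (hX : HasDerivAt X v t) (hY : HasDerivAt Y w t) (hp : (X t, Y t) ∈ slitBundle a m n) :
    HasDerivAt (fun τ => taubNUTRanders a m n (X τ) (Y τ))
      ((1 / 2 * taubNUTDeriv a (X t) v (shift a m n (X t) (Y t)) (shift a m n (X t) (Y t))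
        + pairing (taubNUT a (X t)) (shift a m n (X t) (Y t))
          (w - taubNUTRanders a m n (X t) (Y t) • rotationField m n v))
        / denom a m n (X t) (Y t)) t := by
  have hc := hasDerivAt_comp_curve
    (differentiableAt_of_contDiffOn ha (contDiffOn_taubNUTRanders ha) hp) hX hY
  set c := fderiv ℝ (fun p : (Fin 4 → ℝ) × (Fin 4 → ℝ) => taubNUTRanders a m n p.1 p.2)
    (X t, Y t) (v, w) with hcdef
  clear_value c
  have hs : HasDerivAt (fun τ => shift a m n (X τ) (Y τ))
      (w - (taubNUTRanders a m n (X t) (Y t) • rotationField m n v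
        + c • rotationField m n (X t))) t :=
    hY.fun_sub (hc.fun_smul (hasDerivAt_rotationField m n v hX))
  have h1 := hasDerivAt_pairing_taubNUT ha hX hs hs
  have hnear : ∀ᶠ τ in nhds t, X τ ∈ mildRegion a m n :=
    hX.continuousAt.eventually ((isOpen_mildRegion ha).mem_nhds hp.1)
  have h2 := (hc.fun_pow 2).congr_of_eventuallyEq (f₁ := fun τ => pairing (taubNUT a (X τ))
    (shift a m n (X τ) (Y τ)) (shift a m n (X τ) (Y τ)))
    (hnear.mono fun τ hτ => pairing_navShift_self (posDef_taubNUT ha) hτ)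
  have h3 := h1.unique h2
  have hH := (posDef_taubNUT (x := X t) ha).isHermitian
  have hD := (denom_pos ha hp).ne'
  rw [pairing_comm _ (shift a m n (X t) (Y t)) hH, pairing_sub_right, pairing_add_right,
    pairing_smul_right, pairing_smul_right] at h3
  refine hc.congr_deriv ((eq_div_iff hD).2 ?_)
  have hDe : denom a m n (X t) (Y t) = taubNUTRanders a m n (X t) (Y t)
    + pairing (taubNUT a (X t)) (shift a m n (X t) (Y t)) (rotationField m n (X t)) := rfl
  rw [hDe, pairing_sub_right, pairing_smul_right]
  norm_num at h3
  linarith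

variable (a m n) in
/-- The geodesic coefficients of the Randers metric, with the Christoffel symbols of the Taub-NUT
metric and the components of `W` as ingredients. -/
def randersSpray (x y : Fin 4 → ℝ) : Fin 4 → ℝ :=
  (1 / 2 : ℝ) • christoffel a x (shift a m n x y) (shift a m n x y)
    - taubNUTRanders a m n x y • rotationField m n y
    + (1 / 2 * taubNUTRanders a m n x y ^ 2) • rotationField m n (rotationField m n x)

/-- The fibre-derivatives of `F²` propagate along the spray by the Euler-Lagrange equations. -/
theorem spray_equation (ha : 0 < a) (hp : (x, y) ∈ slitBundle a m n) (l : Fin 4) :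
    ∑ k, y k * dx k (dy l fun x y => taubNUTRanders a m n x y ^ 2) x y
      + ∑ k, (-2 * randersSpray a m n x y k) *
        dy k (dy l fun x y => taubNUTRanders a m n x y ^ 2) x y =
      dx l (fun x y => taubNUTRanders a m n x y ^ 2) x y := by
  have hFs := contDiffOn_taubNUTRanders (m := m) (n := n) ha
  have hO := isOpen_slitBundle (m := m) (n := n) ha
  have hF2 : ContDiffOn ℝ ∞ (fun p : (Fin 4 → ℝ) × (Fin 4 → ℝ) =>
    taubNUTRanders a m n p.1 p.2 ^ 2) (slitBundle a m n) := hFs.pow 2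
  have hH := (posDef_taubNUT (x := x) ha).isHermitian
  have hD := (denom_pos ha hp).ne'
  set F := taubNUTRanders a m n x y with hF
  set z := shift a m n x y with hz
  set G := randersSpray a m n x y with hG
  -- `G` is chosen so that, if `F` is stationary, `z` moves by parallel transport `-Γ(z, z)` plus
  -- the flow term `F M z`.
  have hzG : (-2 : ℝ) • G - F • rotationField m n y
      = F • rotationField m n z - christoffel a x z z := by
    have hMz : rotationField m n z
        = rotationField m n y - F • rotationField m n (rotationField m n x) := by
      rw [hz, shift_eq, rotationField_sub, rotationField_smul]
    rw [hG, randersSpray, ← hF, ← hz, hMz]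
    ext i
    simp only [Pi.sub_apply, Pi.add_apply, Pi.smul_apply, smul_eq_mul]
    norm_num
    ring
  have hy : y = z + F • rotationField m n x := by rw [hz, shift_eq, ← hF]; simp
  -- Split `y = z + F W`; the Killing identity replaces the derivative of the metric along `W` by
  -- `M` acting on the arguments.
  have hder (q : Fin 4 → ℝ) : taubNUTDeriv a x y z q = taubNUTDeriv a x z z q
      - F * (pairing (taubNUT a x) (rotationField m n z) q
        + pairing (taubNUT a x) z (rotationField m n q)) := by
    have hK := taubNUTDeriv_rotationField (m := m) (n := n) (x := x) (p := z) (q := q) ha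
    have hlin : taubNUTDeriv a x y z q = taubNUTDeriv a x z z q
        + F * taubNUTDeriv a x (rotationField m n x) z q := by
      conv_lhs => rw [hy]
      simp only [taubNUTDeriv, hopfForm_add, hopfForm_smul, add_dotProduct, smul_dotProduct,
        dotProduct_add, dotProduct_smul, smul_eq_mul]
      ring
    rw [hlin]; linear_combination F * hK
  have hX := hasDerivAt_line y x
  have hY : HasDerivAt (fun t : ℝ => y + t • ((-2 : ℝ) • G)) ((-2 : ℝ) • G) 0 := hasDerivAt_line _ y
  have hp0 : (x + (0 : ℝ) • y, y + (0 : ℝ) • ((-2 : ℝ) • G)) ∈ slitBundle a m n := by simpa using hp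
  have hf := hasDerivAt_taubNUTRanders ha hX hY hp0
  -- The numerator of the derivative of `F` along `(y, -2G)` vanishes: `F` is constant to first
  -- order along the spray.
  have hf0 : 1 / 2 * taubNUTDeriv a x y z z + pairing (taubNUT a x) z
      ((-2 : ℝ) • G - F • rotationField m n y) = 0 := by
    rw [hzG, hder, pairing_comm _ z hH, pairing_sub_right, pairing_smul_right,
      pairing_comm z (christoffel a x z z) hH, pairing_christoffel_self ha]
    ring
  simp only [zero_smul, add_zero, ← hF, ← hz, hf0, zero_div] at hf
  have hzt : HasDerivAt (fun t : ℝ => shift a m n (x + t • y) (y + t • ((-2 : ℝ) • G)))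
      (F • rotationField m n z - christoffel a x z z) 0 := by
    have := hY.fun_sub (hf.fun_smul (hasDerivAt_rotationField m n y hX))
    refine this.congr_deriv ?_
    simp only [zero_smul, add_zero, ← hF, hzG]
  have hpair {Q : ℝ → Fin 4 → ℝ} {q q' : Fin 4 → ℝ} (hQ : HasDerivAt Q q' 0) (hq : Q 0 = q) :
      HasDerivAt (fun t : ℝ => pairing (taubNUT a (x + t • y))
        (shift a m n (x + t • y) (y + t • ((-2 : ℝ) • G))) (Q t))
      (1 / 2 * taubNUTDeriv a x q z z - F * pairing (taubNUT a x) z (rotationField m n q)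
        + pairing (taubNUT a x) z q') 0 := by
    refine (hasDerivAt_pairing_taubNUT ha hX hzt hQ).congr_deriv ?_
    simp only [zero_smul, add_zero, ← hz, hq]
    rw [hder, pairing_sub_left, pairing_smul_left, pairing_christoffel_self ha]
    ring
  -- `⟨z, W⟩` is conserved as well, as for any Killing field, so only the factor `⟨z, e_l⟩` of `F
  -- ⟨z, e_l⟩ / D` contributes.
  have hDt : HasDerivAt (fun t : ℝ => denom a m n (x + t • y) (y + t • ((-2 : ℝ) • G))) 0 0 := by
    have h1 := hf.fun_add (hpair (hasDerivAt_rotationField m n y hX) (q := rotationField m n x)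
      (by simp))
    refine h1.congr_deriv ?_
    have hK := taubNUTDeriv_rotationField (m := m) (n := n) (x := x) (p := z) (q := z) ha
    have hyW : rotationField m n y
        = rotationField m n z + F • rotationField m n (rotationField m n x) := by
      conv_lhs => rw [hy]
      rw [rotationField_add, rotationField_smul]
    rw [hyW, pairing_add_right, pairing_smul_right]
    rw [pairing_comm (rotationField m n z) z hH] at hK
    linear_combination 1 / 2 * hK
  have hN := hpair (hasDerivAt_const (0 : ℝ) (Pi.single l (1 : ℝ))) rfl
  have hE := (hf.const_mul 2).fun_mul (hN.fun_div hDt (by simpa using hD))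
  have hnear : ∀ᶠ t : ℝ in nhds 0, (x + t • y, y + t • ((-2 : ℝ) • G)) ∈ slitBundle a m n :=
    (hX.continuousAt.prodMk hY.continuousAt).eventually (hO.mem_nhds hp0)
  have hcurve := hE.congr_of_eventuallyEq (f₁ := fun t : ℝ =>
      dy l (fun x y => taubNUTRanders a m n x y ^ 2) (x + t • y) (y + t • ((-2 : ℝ) • G)))
    (hnear.mono fun t ht => dy_sq_navigationMetric (posDef_taubNUT ha) ht.1 ht.2 l)
  have hsum := sum_dx_add_sum_dy
    (differentiableAt_of_contDiffOn ha (contDiffOn_dy hO hF2 l) hp) hcurve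
  have hdx : dx l (fun x y => taubNUTRanders a m n x y ^ 2) x y = 2 * F *
      ((1 / 2 * taubNUTDeriv a x (Pi.single l 1) z z
        - F * pairing (taubNUT a x) z (rotationField m n (Pi.single l 1)))
        / denom a m n x y) := by
    refine partialDeriv_eq_of_hasDerivAt
      (differentiableAt_fst_of_uncurry (H := fun x y => taubNUTRanders a m n x y ^ 2)
        (differentiableAt_of_contDiffOn (H := fun x y => taubNUTRanders a m n x y ^ 2)
          ha hF2 hp)) ?_
    refine ((hasDerivAt_taubNUTRanders ha (hasDerivAt_line (Pi.single l 1) x)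
      (hasDerivAt_const (0 : ℝ) y) (by simpa using hp)).fun_pow 2).congr_deriv ?_
    simp only [zero_smul, add_zero, ← hz, ← hF, zero_sub]
    have h0 : pairing (taubNUT a x) z (-(F • rotationField m n (Pi.single l 1))) =
        - (F * pairing (taubNUT a x) z (rotationField m n (Pi.single l 1))) := by
      rw [← pairing_smul_right]; simp [pairing, mulVec_neg]
    rw [h0, ← sub_eq_add_neg]
    norm_num
  have h0 : pairing (taubNUT a x) z 0 = 0 := by simp [pairing]
  rw [hdx]
  simp only [zero_smul, add_zero, ← hz, ← hF, h0] at hsum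
  simp only [Pi.smul_apply] at hsum
  norm_num at hsum ⊢
  rw [hsum]
  field_simp

theorem geodesicCoeff_taubNUTRanders (ha : 0 < a) (hp : (x, y) ∈ slitBundle a m n) (i : Fin 4) :
    geodesicCoeff (taubNUTRanders a m n) i x y = randersSpray a m n x y i :=
  geodesicCoeff_eq_of_posDef ((isRandersMetric_taubNUTRanders ha).1.convex x hp.1 y hp.2) _
    (spray_equation ha hp) i

end Spray

/-! ### The Ricci curvature of the Randers metric. -/

section Curvature

open Matrix

theorem dx_sum {d : ℕ} {ι : Type*} (s : Finset ι) {H : ι → (Fin d → ℝ) → (Fin d → ℝ) → ℝ}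
    {x y : Fin d → ℝ} (h : ∀ k ∈ s, DifferentiableAt ℝ
      (fun p : (Fin d → ℝ) × (Fin d → ℝ) => H k p.1 p.2) (x, y)) (i : Fin d) :
    dx i (fun x y => ∑ k ∈ s, H k x y) x y = ∑ k ∈ s, dx i (H k) x y := by
  unfold dx partialDeriv
  rw [fderiv_fun_sum fun k hk => differentiableAt_fst_of_uncurry (h k hk)]
  simp

theorem dy_sum {d : ℕ} {ι : Type*} (s : Finset ι) {H : ι → (Fin d → ℝ) → (Fin d → ℝ) → ℝ}
    {x y : Fin d → ℝ} (h : ∀ k ∈ s, DifferentiableAt ℝ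
      (fun p : (Fin d → ℝ) × (Fin d → ℝ) => H k p.1 p.2) (x, y)) (i : Fin d) :
    dy i (fun x y => ∑ k ∈ s, H k x y) x y = ∑ k ∈ s, dy i (H k) x y := by
  unfold dy partialDeriv
  rw [fderiv_fun_sum fun k hk => differentiableAt_snd_of_uncurry (h k hk)]
  simp

section Smooth

variable {E : Type*} [NormedAddCommGroup E] [NormedSpace ℝ E] {s : Set E} {v w : E → Fin 4 → ℝ}

theorem contDiffOn_hopfForm (hv : ∀ i, ContDiffOn ℝ ∞ (fun p => v p i) s) (i : Fin 4) :
    ContDiffOn ℝ ∞ (fun p => hopfForm (v p) i) s := by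
  fin_cases i
  · exact (hv 1).neg
  · exact hv 0
  · exact (hv 3).neg
  · exact hv 2

theorem contDiffOn_rotationField {m n : ℝ} (hv : ∀ i, ContDiffOn ℝ ∞ (fun p => v p i) s)
    (i : Fin 4) : ContDiffOn ℝ ∞ (fun p => rotationField m n (v p) i) s := by
  fin_cases i
  · exact contDiffOn_const.mul (hv 1)
  · exact contDiffOn_const.mul (hv 0)
  · exact contDiffOn_const.mul (hv 3)
  · exact contDiffOn_const.mul (hv 2)

theorem contDiffOn_dotProduct (hv : ∀ i, ContDiffOn ℝ ∞ (fun p => v p i) s)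
    (hw : ∀ i, ContDiffOn ℝ ∞ (fun p => w p i) s) :
    ContDiffOn ℝ ∞ (fun p => v p ⬝ᵥ w p) s :=
  ContDiffOn.sum fun i _ => (hv i).mul (hw i)

end Smooth

variable {a m n : ℝ} {x y v w : Fin 4 → ℝ}

theorem contDiffOn_randersSpray (ha : 0 < a) (i : Fin 4) : ContDiffOn ℝ ∞
    (fun p : (Fin 4 → ℝ) × (Fin 4 → ℝ) => randersSpray a m n p.1 p.2 i) (slitBundle a m n) := by
  have hF := contDiffOn_taubNUTRanders (m := m) (n := n) ha
  have hx : ∀ i, ContDiffOn ℝ ∞ (fun p : (Fin 4 → ℝ) × (Fin 4 → ℝ) => p.1 i)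
    (slitBundle a m n) := fun i => by fun_prop
  have hy : ∀ i, ContDiffOn ℝ ∞ (fun p : (Fin 4 → ℝ) × (Fin 4 → ℝ) => p.2 i)
    (slitBundle a m n) := fun i => by fun_prop
  have hMx := contDiffOn_rotationField (m := m) (n := n) hx
  have hMy := contDiffOn_rotationField (m := m) (n := n) hy
  have hMMx := contDiffOn_rotationField (m := m) (n := n) hMx
  have hz : ∀ i, ContDiffOn ℝ ∞ (fun p : (Fin 4 → ℝ) × (Fin 4 → ℝ) => shift a m n p.1 p.2 i)
    (slitBundle a m n) := fun i => (hy i).sub (hF.mul (hMx i))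
  have hJx := contDiffOn_hopfForm hx
  have hJz := contDiffOn_hopfForm hz
  have hτ := contDiffOn_dotProduct hx hz
  have ht := contDiffOn_dotProduct hJx hz
  have hq := contDiffOn_dotProduct hz hz
  have hU : ContDiffOn ℝ ∞ (fun p : (Fin 4 → ℝ) × (Fin 4 → ℝ) => (conf a p.1)⁻¹)
      (slitBundle a m n) :=
    ((contDiffOn_const.mul (contDiffOn_dotProduct hx hx)).add contDiffOn_const).inv
      fun p _ => (conf_pos ha).ne'
  have hx := hx i
  have hMy := hMy i
  have hMMx := hMMx i
  have hz := hz i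
  have hJx := hJx i
  have hJz := hJz i
  simp only [randersSpray, half_christoffel_self, Pi.add_apply, Pi.sub_apply, Pi.smul_apply,
    smul_eq_mul]
  fun_prop

theorem contDiffOn_geodesicCoeff (ha : 0 < a) (i : Fin 4) : ContDiffOn ℝ ∞
    (fun p : (Fin 4 → ℝ) × (Fin 4 → ℝ) => geodesicCoeff (taubNUTRanders a m n) i p.1 p.2)
    (slitBundle a m n) :=
  (contDiffOn_randersSpray ha i).congr fun _ hp => geodesicCoeff_taubNUTRanders ha hp i

variable (a m n) in
/-- The derivative of `randersSpray` with respect to the value of `F`. -/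
def sprayDrift (x y : Fin 4 → ℝ) : Fin 4 → ℝ :=
  -(christoffel a x (shift a m n x y) (rotationField m n x)
    + rotationField m n (shift a m n x y))

/-- The derivative `c` of `F` is left as a parameter, which separates the derivative at frozen `F`
from the multiple `c` of the drift. This split drives the cancellations in the Ricci trace. -/
theorem hasDerivAt_randersSpray (ha : 0 < a) {X Y : ℝ → Fin 4 → ℝ} {t c : ℝ}
    (hX : HasDerivAt X v t) (hY : HasDerivAt Y w t)
    (hF : HasDerivAt (fun τ => taubNUTRanders a m n (X τ) (Y τ)) c t) :
    HasDerivAt (fun τ => randersSpray a m n (X τ) (Y τ))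
      (christoffelDeriv a (X t) v (shift a m n (X t) (Y t))
        + christoffel a (X t) (shift a m n (X t) (Y t))
            (w - taubNUTRanders a m n (X t) (Y t) • rotationField m n v)
        - taubNUTRanders a m n (X t) (Y t) • rotationField m n w
        + (1 / 2 * taubNUTRanders a m n (X t) (Y t) ^ 2) • rotationField m n (rotationField m n v)
        + c • sprayDrift a m n (X t) (Y t)) t := by
  have hMX := hasDerivAt_rotationField m n v hX
  have hs : HasDerivAt (fun τ => shift a m n (X τ) (Y τ))
      (w - (taubNUTRanders a m n (X t) (Y t) • rotationField m n v
        + c • rotationField m n (X t))) t := hY.fun_sub (hF.fun_smul hMX)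
  have h := ((hasDerivAt_half_christoffel ha hX hs).fun_sub
    (hF.fun_smul (hasDerivAt_rotationField m n w hY))).fun_add
    (((hF.fun_pow 2).const_mul (1 / 2)).fun_smul (hasDerivAt_rotationField m n _ hMX))
  refine h.congr_deriv ?_
  have hsub : w - (taubNUTRanders a m n (X t) (Y t) • rotationField m n v
        + c • rotationField m n (X t)) = (w - taubNUTRanders a m n (X t) (Y t) •
        rotationField m n v) + (-c) • rotationField m n (X t) := by
    rw [neg_smul]; abel
  have hMz : rotationField m n (shift a m n (X t) (Y t)) = rotationField m n (Y t)
      - taubNUTRanders a m n (X t) (Y t) • rotationField m n (rotationField m n (X t)) := by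
    rw [shift_eq, rotationField_sub, rotationField_smul]
  rw [hsub, christoffel_add_right, christoffel_smul_right, sprayDrift, hMz]
  ext i
  simp only [Pi.sub_apply, Pi.add_apply, Pi.smul_apply, Pi.neg_apply, smul_eq_mul]
  norm_num
  ring

variable (m n) in
/-- The matrix of the linear map `rotationField m n`. -/
def rotationMatrix : Matrix (Fin 4) (Fin 4) ℝ :=
  of fun i k => rotationField m n (Pi.single k 1) i

theorem rotationMatrix_mulVec : rotationMatrix m n *ᵥ v = rotationField m n v := by
  ext i
  fin_cases i <;>
    simp [rotationMatrix, rotationField, mulVec, dotProduct, Fin.sum_univ_four]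

theorem trace_rotationMatrix : (rotationMatrix m n).trace = 0 := by
  simp [trace, rotationMatrix, rotationField, Fin.sum_univ_four]

variable (a m n) in
/-- The fibre-derivative of `F`. -/
def fibreDeriv (x y : Fin 4 → ℝ) : Fin 4 → ℝ := fun k =>
  pairing (taubNUT a x) (shift a m n x y) (Pi.single k 1) / denom a m n x y

theorem fibreDeriv_dotProduct :
    fibreDeriv a m n x y ⬝ᵥ v = pairing (taubNUT a x) (shift a m n x y) v / denom a m n x y := by
  rw [← sum_mul_mul_eq_pairing, Finset.sum_comm, dotProduct, Finset.sum_div]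
  refine Finset.sum_congr rfl fun k _ => ?_
  rw [fibreDeriv, ← sum_mul_mul_eq_pairing, ← Finset.sum_mul]
  simp [Pi.single_apply]
  ring

variable (a m n) in
/-- The fibre-derivative of `randersSpray` at a fixed value of `F`. -/
def frozenConnection (x y : Fin 4 → ℝ) : Matrix (Fin 4) (Fin 4) ℝ :=
  christoffelMatrix a x (shift a m n x y) - taubNUTRanders a m n x y • rotationMatrix m n

/-- The drift is `-(Γ(z, W) + M z) = -∇_z W`, and `⟨z, ∇_z W⟩ = 0` because `W` is Killing. -/
theorem fibreDeriv_dotProduct_sprayDrift (ha : 0 < a) :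
    fibreDeriv a m n x y ⬝ᵥ sprayDrift a m n x y = 0 := by
  have hH := (posDef_taubNUT (x := x) ha).isHermitian
  have h1 := taubNUTDeriv_eq (x := x) (p := shift a m n x y) (q := shift a m n x y)
    (w := rotationField m n x) ha
  have h2 := taubNUTDeriv_rotationField (m := m) (n := n) (x := x) (p := shift a m n x y)
    (q := shift a m n x y) ha
  rw [pairing_comm _ (shift a m n x y) hH] at h1 h2
  have h3 : pairing (taubNUT a x) (shift a m n x y) (sprayDrift a m n x y) = 0 := by
    have : sprayDrift a m n x y = (-1 : ℝ) • (christoffel a x (shift a m n x y)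
      (rotationField m n x) + rotationField m n (shift a m n x y)) := by
      rw [neg_one_smul, sprayDrift]
    rw [this, pairing_smul_right, pairing_add_right]
    linarith
  rw [fibreDeriv_dotProduct, h3, zero_div]

/-- `F` enters the spray explicitly and through `z`; its variation contributes only the rank-one
matrix drift times `dF`. -/
theorem dy_geodesicCoeff (ha : 0 < a) (hp : (x, y) ∈ slitBundle a m n) (i k : Fin 4) :
    dy k (geodesicCoeff (taubNUTRanders a m n) i) x y = (frozenConnection a m n x y
      + vecMulVec (sprayDrift a m n x y) (fibreDeriv a m n x y)) i k := by
  rw [dy_congr (K := fun x y => randersSpray a m n x y i) (isOpen_slitBundle ha)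
    (fun p hp => geodesicCoeff_taubNUTRanders ha hp i) hp]
  have hF : HasDerivAt (fun t : ℝ => taubNUTRanders a m n x (y + t • Pi.single k 1))
      (fibreDeriv a m n x y k) 0 :=
    hasDerivAt_navigationMetric_snd (posDef_taubNUT ha) hp.1 hp.2 _
  refine partialDeriv_eq_of_hasDerivAt (differentiableAt_snd_of_uncurry
    (H := fun x y => randersSpray a m n x y i) (differentiableAt_of_contDiffOn
      (H := fun x y => randersSpray a m n x y i) ha (contDiffOn_randersSpray ha i) hp)) ?_
  have h := hasDerivAt_pi.1 (hasDerivAt_randersSpray ha (hasDerivAt_const (0 : ℝ) x)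
    (hasDerivAt_line (Pi.single k 1) y) hF) i
  refine h.congr_deriv ?_
  have h0 : christoffelDeriv a x 0 (shift a m n x y) = 0 := by
    have : hopfForm 0 = 0 := by simpa using hopfForm_smul 0 (0 : ℝ)
    simp [christoffelDeriv, this]
  simp only [zero_smul, add_zero, rotationField_zero, smul_zero, sub_zero, h0, zero_add]
  simp only [frozenConnection, christoffelMatrix, rotationMatrix, Pi.sub_apply, Pi.add_apply,
    Pi.smul_apply, smul_eq_mul, Matrix.add_apply, Matrix.sub_apply, Matrix.smul_apply,
    vecMulVec_apply, of_apply]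
  ring

theorem dx_geodesicCoeff (ha : 0 < a) (hp : (x, y) ∈ slitBundle a m n) (i k : Fin 4) :
    dx k (geodesicCoeff (taubNUTRanders a m n) i) x y =
      christoffelDeriv a x (Pi.single k 1) (shift a m n x y) i
      - taubNUTRanders a m n x y *
        (christoffelMatrix a x (shift a m n x y) * rotationMatrix m n) i k
      + 1 / 2 * taubNUTRanders a m n x y ^ 2 * (rotationMatrix m n * rotationMatrix m n) i k
      + (fibreDeriv a m n x y ᵥ* frozenConnection a m n x y) k * sprayDrift a m n x y i := by
  rw [dx_congr (K := fun x y => randersSpray a m n x y i) (isOpen_slitBundle ha)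
    (fun p hp => geodesicCoeff_taubNUTRanders ha hp i) hp]
  have hX := hasDerivAt_line (Pi.single k 1) x
  have hF := hasDerivAt_taubNUTRanders ha hX (hasDerivAt_const (0 : ℝ) y) (by simpa using hp)
  refine partialDeriv_eq_of_hasDerivAt (differentiableAt_fst_of_uncurry
    (H := fun x y => randersSpray a m n x y i) (differentiableAt_of_contDiffOn
      (H := fun x y => randersSpray a m n x y i) ha (contDiffOn_randersSpray ha i) hp)) ?_
  refine (hasDerivAt_pi.1 (hasDerivAt_randersSpray ha hX (hasDerivAt_const (0 : ℝ) y) hF)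
    i).congr_deriv ?_
  have hH := (posDef_taubNUT (x := x) ha).isHermitian
  -- The `x`-gradient of `F` is its fibre gradient contracted with the frozen connection, by metric
  -- compatibility: `F` is horizontally constant for that connection.
  have hq : (fibreDeriv a m n x y ᵥ* frozenConnection a m n x y) k =
      (1 / 2 * taubNUTDeriv a x (Pi.single k 1) (shift a m n x y) (shift a m n x y)
        + pairing (taubNUT a x) (shift a m n x y)
          (0 - taubNUTRanders a m n x y • rotationField m n (Pi.single k 1)))
        / denom a m n x y := by
    rw [← dotProduct_single_one (fibreDeriv a m n x y ᵥ* _), ← dotProduct_mulVec,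
      frozenConnection, sub_mulVec, smul_mulVec, christoffelMatrix_mulVec, rotationMatrix_mulVec,
      fibreDeriv_dotProduct, taubNUTDeriv_eq ha, pairing_comm _ (shift a m n x y) hH, zero_sub,
      ← neg_smul, pairing_sub_right, pairing_smul_right, pairing_smul_right]
    ring
  have h1 : (christoffelMatrix a x (shift a m n x y) * rotationMatrix m n) i k =
      christoffel a x (shift a m n x y) (rotationField m n (Pi.single k 1)) i := by
    rw [← christoffelMatrix_mulVec]; rfl
  have h2 : (rotationMatrix m n * rotationMatrix m n) i k =
      rotationField m n (rotationField m n (Pi.single k 1)) i := by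
    rw [← rotationMatrix_mulVec]; rfl
  simp only [zero_smul, add_zero, rotationField_zero, smul_zero, sub_zero, ← hq, h1, h2]
  rw [zero_sub, ← neg_smul, christoffel_smul_right]
  simp only [Pi.add_apply, Pi.smul_apply, smul_eq_mul]
  ring

theorem dotProduct_shift : x ⬝ᵥ shift a m n x y = x ⬝ᵥ y := by
  rw [shift_eq, dotProduct_sub, dotProduct_smul, dotProduct_rotationField,
    rotationField_dotProduct_self]
  simp

/-- The divergence of the spray along the fibres. -/
theorem sum_dy_geodesicCoeff (ha : 0 < a) (hp : (x, y) ∈ slitBundle a m n) :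
    ∑ k, dy k (geodesicCoeff (taubNUTRanders a m n) k) x y
      = 2 * a * (x ⬝ᵥ y) * (conf a x)⁻¹ := by
  simp only [dy_geodesicCoeff ha hp]
  change trace _ = _
  rw [trace_add, trace_vecMulVec, dotProduct_comm, fibreDeriv_dotProduct_sprayDrift ha,
    frozenConnection, trace_sub, trace_smul, trace_rotationMatrix, trace_christoffelMatrix ha,
    dotProduct_shift]
  simp

/-- The Ricci curvature of `F` at `y` equals that of `g_a` at `z = y - F W`. In `2 tr(∂G/∂x) -
tr((∂G/∂y)²)` the terms in `tr(NM)`, `tr(M²)` and `p·Bδ` cancel, and the remaining second-derivative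
terms are minus the derivative of the fibre divergence along the spray. -/
theorem ricciCurvature_taubNUTRanders (ha : 0 < a) (hp : (x, y) ∈ slitBundle a m n) :
    ricciCurvature (taubNUTRanders a m n) x y = 0 := by
  have hO := isOpen_slitBundle (m := m) (n := n) ha
  set F := taubNUTRanders a m n x y with hF
  set z := shift a m n x y with hz
  set G := randersSpray a m n x y with hG
  set N := christoffelMatrix a x z with hN
  set M := rotationMatrix m n with hM
  set B := frozenConnection a m n x y with hB
  set δ := sprayDrift a m n x y with hδ
  set p := fibreDeriv a m n x y with hpd
  have hpδ : p ⬝ᵥ δ = 0 := fibreDeriv_dotProduct_sprayDrift ha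
  have hBe : B = N - F • M := rfl
  have hdiff : ∀ k, DifferentiableAt ℝ (fun q : (Fin 4 → ℝ) × (Fin 4 → ℝ) =>
      dy k (geodesicCoeff (taubNUTRanders a m n) k) q.1 q.2) (x, y) := fun k =>
    differentiableAt_of_contDiffOn ha (contDiffOn_dy hO (contDiffOn_geodesicCoeff ha k) k) hp
  have hdx : ∑ k, dx k (geodesicCoeff (taubNUTRanders a m n) k) x y =
      ∑ k, christoffelDeriv a x (Pi.single k 1) z k - F * (N * M).trace
      + 1 / 2 * F ^ 2 * (M * M).trace + p ⬝ᵥ B *ᵥ δ := by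
    simp only [dx_geodesicCoeff ha hp, Finset.sum_add_distrib, Finset.sum_sub_distrib,
      ← Finset.mul_sum, ← hF, ← hz, ← hN, ← hM, ← hB, ← hδ, ← hpd]
    rw [dotProduct_mulVec]
    rfl
  have hdy : ∑ k, ∑ j, dy j (geodesicCoeff (taubNUTRanders a m n) k) x y
      * dy k (geodesicCoeff (taubNUTRanders a m n) j) x y =
      (N * N).trace - 2 * F * (N * M).trace + F ^ 2 * (M * M).trace + 2 * (p ⬝ᵥ B *ᵥ δ) := by
    simp only [dy_geodesicCoeff ha hp, ← hB, ← hδ, ← hpd]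
    change trace ((B + vecMulVec δ p) * (B + vecMulVec δ p)) = _
    have hBB : (B * B).trace = (N * N).trace - 2 * F * (N * M).trace + F ^ 2 * (M * M).trace := by
      rw [hBe]
      simp only [Matrix.mul_sub, Matrix.sub_mul, Matrix.smul_mul, Matrix.mul_smul, trace_sub,
        trace_smul, trace_mul_comm M N, smul_eq_mul]
      ring
    rw [Matrix.mul_add, Matrix.add_mul, Matrix.add_mul, vecMulVec_mul_vecMulVec, hpδ, zero_smul,
      vecMulVec_zero, mul_vecMulVec, vecMulVec_mul, trace_add, trace_add, trace_add, hBB,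
      trace_vecMulVec, trace_vecMulVec, trace_zero, dotProduct_comm δ, ← dotProduct_mulVec,
      dotProduct_comm _ p]
    ring
  -- The second derivatives in the trace amount to one directional derivative, along `(y, -2G)`, of
  -- the closed form `2a (x·y) / u` of the divergence.
  have hcurve : HasDerivAt (fun t : ℝ => ∑ k,
      dy k (geodesicCoeff (taubNUTRanders a m n) k) (x + t • y) (y + t • ((-2 : ℝ) • G)))
      (2 * a * (y ⬝ᵥ y - 2 * (x ⬝ᵥ G)) * (conf a x)⁻¹
        - 4 * a ^ 2 * (x ⬝ᵥ y) ^ 2 * (conf a x)⁻¹ ^ 2) 0 := by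
    have hX := hasDerivAt_line y x
    have hY := hasDerivAt_line ((-2 : ℝ) • G) y
    have hnear : ∀ᶠ t : ℝ in nhds 0,
        (x + t • y, y + t • ((-2 : ℝ) • G)) ∈ slitBundle a m n :=
      (hX.continuousAt.prodMk hY.continuousAt).eventually (hO.mem_nhds (by simpa using hp))
    refine ((((hasDerivAt_dotProduct hX hY).const_mul (2 * a)).fun_mul
      (hasDerivAt_conf_inv ha hX)).congr_of_eventuallyEq
        (hnear.mono fun t ht => sum_dy_geodesicCoeff ha ht)).congr_deriv ?_
    simp only [zero_smul, add_zero, dotProduct_smul, smul_eq_mul]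
    ring
  have hsum := sum_dx_add_sum_dy (H := fun x y => ∑ k,
    dy k (geodesicCoeff (taubNUTRanders a m n) k) x y)
    (DifferentiableAt.fun_sum fun k _ => hdiff k) hcurve
  simp only [dx_sum _ fun k _ => hdiff k, dy_sum _ fun k _ => hdiff k] at hsum
  -- Skewness of `M` absorbs every term with `F`, leaving the expression that `g_a` gives for `z`.
  have hyz : y ⬝ᵥ y - 2 * (x ⬝ᵥ G)
      = z ⬝ᵥ z - 2 * (x ⬝ᵥ (1 / 2 : ℝ) • christoffel a x z z) := by
    have hy : y = z + F • rotationField m n x := by rw [hz, shift_eq, ← hF]; simp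
    rw [hG, randersSpray, ← hF, ← hz]
    generalize (1 / 2 : ℝ) • christoffel a x z z = g
    rw [hy]
    simp only [rotationField_add, rotationField_smul, dotProduct_add, dotProduct_sub,
      dotProduct_smul, add_dotProduct, smul_dotProduct, smul_eq_mul,
      dotProduct_rotationField m n x, dotProduct_comm z (rotationField m n x)]
    ring
  have hric := taubNUT_ricci_flat (x := x) (y := z) ha
  have htr : ricciCurvature (taubNUTRanders a m n) x y =
      2 * ∑ k, dx k (geodesicCoeff (taubNUTRanders a m n) k) x y
      - (∑ i, y i * ∑ k, dx i (dy k (geodesicCoeff (taubNUTRanders a m n) k)) x y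
        + ∑ i, ((-2 : ℝ) • G) i * ∑ k, dy i (dy k (geodesicCoeff (taubNUTRanders a m n) k)) x y)
      - ∑ k, ∑ j, dy j (geodesicCoeff (taubNUTRanders a m n) k) x y
        * dy k (geodesicCoeff (taubNUTRanders a m n) j) x y := by
    simp only [ricciCurvature, riemannCurvature, geodesicCoeff_taubNUTRanders ha hp, ← hG,
      Finset.sum_sub_distrib, Finset.sum_add_distrib, ← Finset.mul_sum, Pi.smul_apply,
      smul_eq_mul, mul_assoc]
    rw [Finset.sum_comm (f := fun k j => y j * dx j (dy k _) x y),
      Finset.sum_comm (f := fun k j => G j * dy j (dy k _) x y)]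
    simp only [← Finset.mul_sum]
    ring
  have hτ : x ⬝ᵥ y = x ⬝ᵥ z := dotProduct_shift.symm
  rw [htr, hsum, hdx, hdy, hyz, hτ]
  linear_combination hric

end Curvature

/-! ### The region `{f < 1}` and the norm of `W`. -/

section Region

variable {a m n : ℝ}

/-- With `r`, `s` the squared radii in the two coordinate planes, `u² = 1 + a(u + 1)(r + s)` and
Lagrange's identity `(r + s)(m²r + n²s) - (mr + ns)² = rs(m - n)²` give the cross term, which
vanishes for `m = n`. -/
theorem normSq_taubNUT_mul_conf (ha : 0 < a) (x : Fin 4 → ℝ) :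
    normSq (taubNUT a) (rotationField m n) x * conf a x =
      m ^ 2 * (x 0 ^ 2 + x 1 ^ 2) + n ^ 2 * (x 2 ^ 2 + x 3 ^ 2)
      + a * (conf a x + 1) * ((x 0 ^ 2 + x 1 ^ 2) * (x 2 ^ 2 + x 3 ^ 2)) * (m - n) ^ 2 := by
  have hu := (conf_pos (x := x) ha).ne'
  have hr : conf a x = a * (x 0 ^ 2 + x 1 ^ 2 + (x 2 ^ 2 + x 3 ^ 2)) + 1 := by
    simp only [conf, dotProduct, Fin.sum_univ_four]; ring
  have h1 : rotationField m n x ⬝ᵥ rotationField m n x =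
      m ^ 2 * (x 0 ^ 2 + x 1 ^ 2) + n ^ 2 * (x 2 ^ 2 + x 3 ^ 2) := by
    simp [rotationField, dotProduct, Fin.sum_univ_four]; ring
  have h2 : hopfForm x ⬝ᵥ rotationField m n x =
      m * (x 0 ^ 2 + x 1 ^ 2) + n * (x 2 ^ 2 + x 3 ^ 2) := by
    simp [rotationField, hopfForm, dotProduct, Fin.sum_univ_four]; ring
  rw [normSq_eq, pairing_taubNUT ha, h1, h2]
  generalize x 0 ^ 2 + x 1 ^ 2 = r at *
  generalize x 2 ^ 2 + x 3 ^ 2 = s at *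
  generalize conf a x = u at *
  field_simp
  rw [hr]
  ring

/-- After multiplication by `u`, the bounds `m², n² ≤ p²`, `rs ≤ (r + s)²` and `(m - n)² ≤ p|m - n|`
compare the two sides term by term. The last one needs `m, n > 0`. -/
theorem normSq_le_radiusBound (ha : 0 < a) (hm : 0 < m) (hn : 0 < n) (x : Fin 4 → ℝ) :
    normSq (taubNUT a) (rotationField m n) x ≤ radiusBound a m n x := by
  have hu := conf_pos (x := x) ha
  have he : euclSq x = x 0 ^ 2 + x 1 ^ 2 + (x 2 ^ 2 + x 3 ^ 2) := by
    simp [euclSq, Fin.sum_univ_four]; ring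
  have hr : conf a x = 1 + a * euclSq x := by rw [conf, euclSq_eq]; ring
  have h := normSq_taubNUT_mul_conf (m := m) (n := n) ha x
  have hb : radiusBound a m n x * conf a x = max m n ^ 2 * euclSq x
      + a * (conf a x + 1) * euclSq x ^ 2 * (max m n * |m - n|) := by
    rw [radiusBound, ← hr]
    field_simp
    rw [hr]
    ring
  have hr0 : 0 ≤ x 0 ^ 2 + x 1 ^ 2 := by positivity
  have hs0 : 0 ≤ x 2 ^ 2 + x 3 ^ 2 := by positivity
  have hp : 0 < max m n := lt_max_of_lt_left hm
  refine le_of_mul_le_mul_right ?_ hu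
  rw [h, hb, he]
  generalize x 0 ^ 2 + x 1 ^ 2 = r at *
  generalize x 2 ^ 2 + x 3 ^ 2 = s at *
  have hm2 : m ^ 2 ≤ max m n ^ 2 := pow_le_pow_left₀ hm.le (le_max_left _ _) 2
  have hn2 : n ^ 2 ≤ max m n ^ 2 := pow_le_pow_left₀ hn.le (le_max_right _ _) 2
  have habs : |m - n| ≤ max m n := abs_le.2
    ⟨by linarith [le_max_right m n], by linarith [le_max_left m n]⟩
  have hsq : (m - n) ^ 2 ≤ max m n * |m - n| := by
    rw [← sq_abs, sq]; exact mul_le_mul_of_nonneg_right habs (abs_nonneg _)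
  have hrs : r * s ≤ (r + s) ^ 2 := by nlinarith
  have h1 : m ^ 2 * r + n ^ 2 * s ≤ max m n ^ 2 * (r + s) := by nlinarith
  have h2 : a * (conf a x + 1) * (r * s) * (m - n) ^ 2
      ≤ a * (conf a x + 1) * (r + s) ^ 2 * (max m n * |m - n|) := by gcongr
  linarith

theorem isOpen_region (ha : 0 < a) : IsOpen (region a m n) := by
  have he : Continuous euclSq := by unfold euclSq; fun_prop
  refine isOpen_lt ?_ continuous_const
  unfold radiusBound
  refine ((he.const_mul _).div (by fun_prop) fun x => ?_).mul (by fun_prop)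
  have := conf_pos (x := x) ha
  rw [conf, ← euclSq_eq] at this
  linarith

theorem zero_mem_region : (0 : Fin 4 → ℝ) ∈ region a m n := by
  simp [region, radiusBound, euclSq]

theorem region_subset_mildRegion (ha : 0 < a) (hm : 0 < m) (hn : 0 < n) :
    region a m n ⊆ mildRegion a m n :=
  fun x hx => (normSq_le_radiusBound ha hm hn x).trans_lt hx

theorem region_eq_univ (ha : 0 < a) (h : m ^ 2 ≤ a) : region a m m = Set.univ := by
  refine Set.eq_univ_of_forall fun x => ?_
  have he : 0 ≤ euclSq x := Finset.sum_nonneg fun i _ => sq_nonneg _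
  have hu : 0 < 1 + a * euclSq x := by positivity
  have : radiusBound a m m x = m ^ 2 * euclSq x / (1 + a * euclSq x) := by
    simp [radiusBound]; ring
  change radiusBound a m m x < 1
  rw [this, div_lt_one hu]
  nlinarith

end Region

/-! ### Curvature at the origin and failure of constant flag curvature. -/

section FlagCurvature

open Matrix

variable {a m n : ℝ}

theorem conf_zero : conf a 0 = 1 := by simp [conf]

theorem hopfForm_zero : hopfForm 0 = 0 := by simpa using hopfForm_smul 0 (0 : ℝ)

theorem shift_zero (y : Fin 4 → ℝ) : shift a m n 0 y = y := by
  rw [shift_eq, rotationField_zero]; simp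

theorem pairing_taubNUT_zero (ha : 0 < a) (v w : Fin 4 → ℝ) :
    pairing (taubNUT a 0) v w = v ⬝ᵥ w := by
  rw [pairing_taubNUT ha, conf_zero, hopfForm_zero]; simp

theorem zero_mem_mildRegion : (0 : Fin 4 → ℝ) ∈ mildRegion a m n := by
  change normSq _ _ _ < 1
  simp [normSq_eq, rotationField_zero, pairing]

theorem zero_single_mem_slitBundle :
    ((0 : Fin 4 → ℝ), (Pi.single 0 1 : Fin 4 → ℝ)) ∈ slitBundle a m n :=
  ⟨zero_mem_mildRegion, by simp⟩

/-- At the origin `W = 0` and `g_a` is Euclidean, so Zermelo's equation reads `F² = |y|²`. -/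
theorem taubNUTRanders_zero_single (ha : 0 < a) :
    taubNUTRanders a m n 0 (Pi.single 0 1) = 1 := by
  have h1 := pairing_navShift_self (y := Pi.single 0 1) (posDef_taubNUT (x := 0) ha)
    (zero_mem_mildRegion (a := a) (m := m) (n := n))
  have h2 := navigationMetric_pos (y := Pi.single 0 1) (posDef_taubNUT (x := 0) ha)
    (zero_mem_mildRegion (a := a) (m := m) (n := n)) (by simp)
  change pairing _ (shift a m n _ _) (shift a m n _ _) = taubNUTRanders a m n _ _ ^ 2 at h1
  change 0 < taubNUTRanders a m n _ _ at h2
  rw [shift_zero, pairing_taubNUT_zero ha, dotProduct_single_one, Pi.single_eq_same] at h1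
  exact (pow_eq_one_iff_of_nonneg h2.le two_ne_zero).1 h1.symm

theorem denom_zero_single (ha : 0 < a) : denom a m n 0 (Pi.single 0 1) = 1 := by
  change taubNUTRanders a m n _ _ + pairing _ _ _ = _
  rw [taubNUTRanders_zero_single ha, rotationField_zero]
  simp [pairing]

theorem fibreDeriv_zero_single (ha : 0 < a) :
    fibreDeriv a m n 0 (Pi.single 0 1) = Pi.single 0 1 := by
  ext k
  rw [fibreDeriv, denom_zero_single ha, shift_zero, pairing_taubNUT_zero ha, div_one,
    dotProduct_single_one]

theorem christoffel_zero (v w : Fin 4 → ℝ) : christoffel a 0 v w = 0 := by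
  simp [christoffel, hopfForm_zero]

theorem christoffelMatrix_zero (v : Fin 4 → ℝ) : christoffelMatrix a 0 v = 0 := by
  ext i k; simp [christoffelMatrix, christoffel_zero]

theorem sprayDrift_zero_single :
    sprayDrift a m n 0 (Pi.single 0 1) = -rotationField m n (Pi.single 0 1) := by
  rw [sprayDrift, christoffel_zero, shift_zero, zero_add]

theorem randersSpray_zero_single (ha : 0 < a) :
    randersSpray a m n 0 (Pi.single 0 1) = -rotationField m n (Pi.single 0 1) := by
  rw [randersSpray, christoffel_zero, taubNUTRanders_zero_single ha, rotationField_zero,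
    rotationField_zero]
  simp

theorem dy_taubNUTRanders_zero_single (ha : 0 < a) (k : Fin 4) :
    dy k (taubNUTRanders a m n) 0 (Pi.single 0 1) = (Pi.single 0 1 : Fin 4 → ℝ) k := by
  have h := dy_navigationMetric (y := Pi.single 0 1) (posDef_taubNUT (x := 0) ha)
    (zero_mem_mildRegion (a := a) (m := m) (n := n)) (by simp) k
  exact h.trans (congrFun (fibreDeriv_zero_single ha) k)

/-- The connection coefficient `∂G³/∂y³` on the totally geodesic plane `x³ = x⁴ = 0`. -/
theorem dy_geodesicCoeff_of_plane (ha : 0 < a) {x y : Fin 4 → ℝ}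
    (hp : (x, y) ∈ slitBundle a m n) (hx2 : x 2 = 0) (hx3 : x 3 = 0) (hy2 : y 2 = 0)
    (hy3 : y 3 = 0) :
    dy 2 (geodesicCoeff (taubNUTRanders a m n) 2) x y = a * (x ⬝ᵥ y) * (conf a x)⁻¹ := by
  have hz2 : shift a m n x y 2 = 0 := by rw [shift_eq]; simp [rotationField, hx3, hy2]
  have hz3 : shift a m n x y 3 = 0 := by rw [shift_eq]; simp [rotationField, hx2, hy3]
  have hJx : hopfForm x 2 = 0 := by simp [hopfForm, hx3]
  have hp2 : fibreDeriv a m n x y 2 = 0 := by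
    simp only [fibreDeriv, pairing_taubNUT ha, dotProduct_single_one, hz2, hJx]
    simp
  have hJ : hopfForm (Pi.single 2 1) 2 = 0 := by simp [hopfForm]
  have hJz : hopfForm (shift a m n x y) 2 = 0 := by simp [hopfForm, hz3]
  rw [dy_geodesicCoeff ha hp, Matrix.add_apply, vecMulVec_apply, hp2, mul_zero, add_zero,
    frozenConnection, Matrix.sub_apply, Matrix.smul_apply]
  simp only [christoffelMatrix, rotationMatrix, of_apply, christoffel, Pi.add_apply, Pi.sub_apply,
    Pi.smul_apply, smul_eq_mul, dotProduct_single_one, Pi.single_eq_same, hx2, hz2, hJx, hJ, hJz,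
    dotProduct_shift]
  simp [rotationField]
  ring

/-- The rotation drops out: the `-n²` in twice the `x`-derivative is compensated by the product of
first fibre derivatives. The remaining `-a - a` comes from the derivative of `Γ` and from the
derivative of the connection along the spray. -/
theorem riemannCurvature_origin (ha : 0 < a) :
    riemannCurvature (taubNUTRanders a m n) 2 2 0 (Pi.single 0 1) = -2 * a := by
  have hp := zero_single_mem_slitBundle (a := a) (m := m) (n := n)
  have hO := isOpen_slitBundle (m := m) (n := n) ha
  set e : Fin 4 → ℝ := Pi.single 0 1 with he
  have h1 : dx 2 (geodesicCoeff (taubNUTRanders a m n) 2) 0 e = -a / 2 - n ^ 2 / 2 := by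
    rw [dx_geodesicCoeff ha hp, taubNUTRanders_zero_single ha, sprayDrift_zero_single, shift_zero,
      christoffelMatrix_zero]
    have hM : (rotationMatrix m n * rotationMatrix m n) 2 2 = -n ^ 2 := by
      simp [Matrix.mul_apply, rotationMatrix, rotationField, Fin.sum_univ_four]
      ring
    have hc : christoffelDeriv a 0 (Pi.single 2 1) e 2 = -a / 2 := by
      have hJ : hopfForm e 2 = 0 := by simp [he, hopfForm]
      have hJ' : hopfForm (Pi.single 2 1) ⬝ᵥ e = 0 := by simp [he, hopfForm]
      simp only [christoffelDeriv, hopfForm_zero, conf_zero, Pi.sub_apply, Pi.smul_apply, hJ, hJ']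
      simp [he]
      ring
    rw [hM, hc]
    simp [rotationField, he]
    ring
  have h2 : ∑ j, dy j (geodesicCoeff (taubNUTRanders a m n) 2) 0 e
      * dy 2 (geodesicCoeff (taubNUTRanders a m n) j) 0 e = -n ^ 2 := by
    simp only [dy_geodesicCoeff ha hp]
    simp only [frozenConnection, shift_zero, christoffelMatrix_zero,
      taubNUTRanders_zero_single ha, sprayDrift_zero_single, fibreDeriv_zero_single ha, he, Matrix.add_apply, Matrix.sub_apply,
      Matrix.smul_apply, vecMulVec_apply, rotationMatrix, of_apply]
    simp [rotationField, Fin.sum_univ_four]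
    ring
  -- At the origin `G = -M e`, so the spray direction is `(e, 2 M e)`. It stays in the plane `x³ =
  -- x⁴ = 0`, where the connection coefficient has a closed form.
  have hcurve : HasDerivAt (fun t : ℝ => dy 2 (geodesicCoeff (taubNUTRanders a m n) 2)
      (0 + t • e) (e + t • ((2 : ℝ) • rotationField m n e))) a 0 := by
    have hX := hasDerivAt_line e 0
    have hY := hasDerivAt_line ((2 : ℝ) • rotationField m n e) e
    have hnear : ∀ᶠ t : ℝ in nhds 0,
        (0 + t • e, e + t • ((2 : ℝ) • rotationField m n e)) ∈ slitBundle a m n :=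
      (hX.continuousAt.prodMk hY.continuousAt).eventually (hO.mem_nhds (by simpa using hp))
    refine ((((hasDerivAt_dotProduct hX hY).const_mul a).fun_mul
      (hasDerivAt_conf_inv ha hX)).congr_of_eventuallyEq (hnear.mono fun t ht =>
        dy_geodesicCoeff_of_plane ha ht ?_ ?_ ?_ ?_)).congr_deriv ?_
    · simp [he]
    · simp [he]
    · simp [he, rotationField]
    · simp [he, rotationField]
    · simp [he, conf_zero]
  have hsum := sum_dx_add_sum_dy (differentiableAt_of_contDiffOn ha
    (contDiffOn_dy hO (contDiffOn_geodesicCoeff ha 2) 2) hp) hcurve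
  have h3 : ∑ j, geodesicCoeff (taubNUTRanders a m n) j 0 e
      * dy j (dy 2 (geodesicCoeff (taubNUTRanders a m n) 2)) 0 e = -(1 / 2) *
      ∑ j, ((2 : ℝ) • rotationField m n e) j
        * dy j (dy 2 (geodesicCoeff (taubNUTRanders a m n) 2)) 0 e := by
    rw [Finset.mul_sum]
    refine Finset.sum_congr rfl fun j _ => ?_
    rw [geodesicCoeff_taubNUTRanders ha hp, randersSpray_zero_single ha]
    simp only [Pi.neg_apply, Pi.smul_apply, smul_eq_mul]
    ring
  rw [riemannCurvature, h1, h2, h3]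
  linear_combination -hsum

/-- At the origin with `y = e₁`, tracing the flag curvature equation gives `3K = 0`, while its third
diagonal entry gives `K = -2a`. -/
theorem not_hasConstantFlagCurvature (ha : 0 < a) {U : Set (Fin 4 → ℝ)} (h0 : 0 ∈ U) :
    ¬ HasConstantFlagCurvature (taubNUTRanders a m n) U := by
  rintro ⟨K, hK⟩
  have hp := zero_single_mem_slitBundle (a := a) (m := m) (n := n)
  have h := hK 0 h0 (Pi.single 0 1) (by simp)
  have h1 := h 2 2
  have hric := ricciCurvature_taubNUTRanders ha hp
  simp only [ricciCurvature, h, dy_taubNUTRanders_zero_single ha, taubNUTRanders_zero_single ha] at hric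
  simp [Fin.sum_univ_four] at hric
  rw [riemannCurvature_origin ha, dy_taubNUTRanders_zero_single ha, taubNUTRanders_zero_single ha] at h1
  simp at h1
  linarith

end FlagCurvature

/-! ### Restriction to subsets of `|W| < 1` and the final assembly. -/

theorem IsRandersMetric.mono {d : ℕ} {F : (Fin d → ℝ) → (Fin d → ℝ) → ℝ} {U V : Set (Fin d → ℝ)}
    (h : IsRandersMetric F V) (hUV : U ⊆ V) : IsRandersMetric F U := by
  obtain ⟨hF, α, b, hα, hb, hlt, heq⟩ := h
  exact ⟨⟨hF.smooth.mono (Set.prod_mono hUV subset_rfl), fun x hx => hF.pos x (hUV hx),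
    fun x hx => hF.homogeneous x (hUV hx), fun x hx => hF.convex x (hUV hx)⟩, α, b,
    ⟨fun i j => (hα.1 i j).mono hUV, fun x hx => hα.2 x (hUV hx)⟩, fun i => (hb i).mono hUV,
    fun x hx => hlt x (hUV hx), fun x hx => heq x (hUV hx)⟩

theorem taubNUTRanders_properties {a m n : ℝ} (ha : 0 < a) {U : Set (Fin 4 → ℝ)}
    (hU : U ⊆ mildRegion a m n) (h0 : 0 ∈ U) :
    IsRandersMetric (taubNUTRanders a m n) U ∧ IsEinsteinWith (taubNUTRanders a m n) U (fun _ => 0)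
      ∧ ¬ HasConstantFlagCurvature (taubNUTRanders a m n) U := by
  refine ⟨(isRandersMetric_taubNUTRanders ha).mono hU, fun x hx y hy => ?_,
    not_hasConstantFlagCurvature ha h0⟩
  rw [ricciCurvature_taubNUTRanders ha ⟨hU hx, hy⟩]
  simp

end Finsler

end

theorem theorem1 (a m n : ℝ) (ha : 0 < a) (hm : 0 < m) (hn : 0 < n) :
    -- the region is an open neighbourhood of the origin on which `|W| < 1`
    (IsOpen (Finsler.region a m n) ∧ (0 : Fin 4 → ℝ) ∈ Finsler.region a m n ∧
      ∀ x ∈ Finsler.region a m n,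
        Finsler.normSq (Finsler.taubNUT a) (Finsler.rotationField m n) x < 1) ∧
    -- the three properties on the region
    (Finsler.IsRandersMetric (Finsler.taubNUTRanders a m n) (Finsler.region a m n) ∧
      Finsler.IsEinsteinWith (Finsler.taubNUTRanders a m n) (Finsler.region a m n)
        (fun _ => 0) ∧
      ¬ Finsler.HasConstantFlagCurvature (Finsler.taubNUTRanders a m n)
        (Finsler.region a m n)) ∧
    -- the three properties on every open neighbourhood of the origin on which `|W| < 1`
    (∀ U : Set (Fin 4 → ℝ), IsOpen U → (0 : Fin 4 → ℝ) ∈ U →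
      (∀ x ∈ U, Finsler.normSq (Finsler.taubNUT a) (Finsler.rotationField m n) x < 1) →
      Finsler.IsRandersMetric (Finsler.taubNUTRanders a m n) U ∧
        Finsler.IsEinsteinWith (Finsler.taubNUTRanders a m n) U (fun _ => 0) ∧
        ¬ Finsler.HasConstantFlagCurvature (Finsler.taubNUTRanders a m n) U) ∧
    -- the global members of the family
    (m = n → m ^ 2 ≤ a → Finsler.region a m n = Set.univ) := by
  have hsub : Finsler.region a m n ⊆ Finsler.mildRegion a m n :=
    Finsler.region_subset_mildRegion ha hm hn
  refine ⟨⟨Finsler.isOpen_region ha, Finsler.zero_mem_region, fun x hx => hsub hx⟩,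
    Finsler.taubNUTRanders_properties ha hsub Finsler.zero_mem_region,
    fun U _ h0 hU => Finsler.taubNUTRanders_properties ha hU h0, ?_⟩
  rintro rfl h
  exact Finsler.region_eq_univ ha h
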